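/- Let $K$ be a field. **Atom spectrum.** Let $\mathcal{G}$ be a Grothendieck category. A nonzero object $H$ is *monoform* if for every nonzero subobject $L\subset H$ the only subobject of $H$ isomorphic to a subobject of $H/L$ is $0$. Two monoform objects are *atom-equivalent* if some nonzero subobject of the first is isomorphic to a subobject of the second. The atom spectrum $\operatorname{ASpec}\mathcal{G}$ is the set of monoform objects modulo atom equivalence; the class of $H$ is written $\overline{H}$. For an object $M$, $\operatorname{ASupp}M$ is the set of all $\overline{H}$ with $H$ a monoform subquotient of $M$. The sets $\operatorname{ASupp}M$ are the open sets of a topology on $\operatorname{ASpec}\mathcal{G}$, and $\alpha\le\beta$ means that $\alpha$ lies in the closure of $\{\beta\}$. A nonzero object $H$ is *compressible* if every nonzero subobject of $H$ contains a subobject isomorphic to $H$. A Grothendieck category is *locally noetherian* if it has a small generating set of noetherian objects. **Colored quivers.** A colored quiver $\Gamma$ consists of sets $\Gamma_0$ (vertices), $\Gamma_1$ (arrows), $C$ (colors) and maps $s,t\colon\Gamma_1\to\Gamma_0$, $u\colon\Gamma_1\to C$. A path $\mathbf{r}$ (paths of length $0$ at each vertex included) has a source $s(\mathbf{r})$, a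 target $t(\mathbf{r})$ and a sequence of colors $u(\mathbf{r})$ in the free monoid $C^*$. Let $K\langle\langle C\rangle\rangle=\prod_{\mathbf{c}\in C^*}K\mathbf{c}$ with the product that extends concatenation of words. Let $F_\Gamma\subset K\langle\langle C\rangle\rangle$ be the subalgebra of those $f=\sum_{\mathbf{c}}\lambda_{\mathbf{c}}\mathbf{c}$ such that for each vertex $v$ there are only finitely many paths $\mathbf{r}$ with $t(\mathbf{r})=v$ and $\lambda_{u(\mathbf{r})}\ne 0$. Let $M_\Gamma=\prod_{v\in\Gamma_0}Kx_v$ be the right $F_\Gamma$-module with $$\Big(\sum_v\mu_vx_v\Big)\Big(\sum_{\mathbf{c}}\lambda_{\mathbf{c}}\mathbf{c}\Big)=\sum_{\mathbf{r}}\lambda_{u(\mathbf{r})}\mu_{s(\mathbf{r})}x_{t(\mathbf{r})},$$ where $\mathbf{r}$ runs over all paths in $\Gamma$. Let $\mathcal{G}_\Gamma$ be the smallest full subcategory of $\operatorname{Mod}F_\Gamma$ that contains $M_\Gamma$ and is closed under subobjects, quotients and small direct sums. **Theorem.** For every finite partially ordered set $P$ there is a colored quiver $\Gamma$ such that: 1.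 $M_\Gamma$ is a noetherian object of $\mathcal{G}_\Gamma$, and $\mathcal{G}_\Gamma$ is a locally noetherian Grothendieck category; 2. every nonzero object of $\mathcal{G}_\Gamma$ contains a compressible subobject; 3. $\operatorname{ASpec}\mathcal{G}_\Gamma$ is isomorphic to $P$ as a partially ordered set. -/

import Mathlib

open CategoryTheory CategoryTheory.Limits

universe u v w

/-! ### Atoms in an abelian category -/

namespace AtomSpectrum

section Category

variable {C : Type w} [Category.{v} C]

/-- `H` is (isomorphic to) a subquotient of `M`, that is, a quotient of a subobject of `M`. -/
def IsSubquotient (H M : C) : Prop :=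
  ∃ (L : C) (i : L ⟶ M) (p : L ⟶ H), Mono i ∧ Epi p

variable [Abelian C]

/-- A monoform object: a nonzero object `H` such that for every nonzero subobject `L` of `H`, the
only subobject of `H` isomorphic to some subobject of `H / L` is zero. -/
def IsMonoform (H : C) : Prop :=
  ¬ IsZero H ∧ ∀ L : Subobject H, L ≠ ⊥ → ∀ N : Subobject H,
    (∃ Q : Subobject (cokernel L.arrow), Nonempty ((N : C) ≅ (Q : C))) → N = ⊥

/-- A compressible object: a nonzero object `H` each of whose nonzero subobjects contains a
subobject isomorphic to `H`. -/
def IsCompressible (H : C) : Prop :=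
  ¬ IsZero H ∧ ∀ L : Subobject H, L ≠ ⊥ → ∃ N : Subobject H, N ≤ L ∧ Nonempty ((N : C) ≅ H)

/-- Atom equivalence: `H₁` has a nonzero subobject isomorphic to some subobject of `H₂`. -/
def AtomEquiv (H₁ H₂ : C) : Prop :=
  ∃ L₁ : Subobject H₁, L₁ ≠ ⊥ ∧ ∃ L₂ : Subobject H₂, Nonempty ((L₁ : C) ≅ (L₂ : C))

lemma subobject_ne_bot_iff {H : C} (L : Subobject H) : L ≠ ⊥ ↔ ¬ IsZero (L : C) := by
  have h : L = ⊥ ↔ L.arrow = 0 := by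
    conv_lhs => rw [← Subobject.mk_arrow L]
    exact Subobject.mk_eq_bot_iff_zero
  rw [ne_eq, h, not_iff_not]
  constructor
  · intro h0
    rw [IsZero.iff_id_eq_zero, ← cancel_mono L.arrow, h0]
    simp
  · intro hz
    exact hz.eq_of_src _ _

lemma atomEquiv_iff (H₁ H₂ : C) : AtomEquiv H₁ H₂ ↔
    ∃ (X : C) (i : X ⟶ H₁) (j : X ⟶ H₂), ¬ IsZero X ∧ Mono i ∧ Mono j := by
  constructor
  · rintro ⟨L₁, h₁, L₂, ⟨e⟩⟩
    exact ⟨L₁, L₁.arrow, e.hom ≫ L₂.arrow, (subobject_ne_bot_iff L₁).1 h₁, inferInstance,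
      inferInstance⟩
  · rintro ⟨X, i, j, hX, hi, hj⟩
    refine ⟨Subobject.mk i, ?_, Subobject.mk j,
      ⟨Subobject.underlyingIso i ≪≫ (Subobject.underlyingIso j).symm⟩⟩
    rw [subobject_ne_bot_iff]
    exact fun h => hX (h.of_iso (Subobject.underlyingIso i).symm)

/-- Two nonzero subobjects of a monoform object meet in a nonzero subobject. -/
lemma IsMonoform.inf_ne_bot {H : C} (hH : IsMonoform H) {L N : Subobject H} (hL : L ≠ ⊥)
    (hN : N ≠ ⊥) : L ⊓ N ≠ ⊥ := by
  intro hLN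
  have hm : Mono (N.arrow ≫ cokernel.π L.arrow) := by
    refine Preadditive.mono_of_cancel_zero _ fun {G} g hg => ?_
    have hk : (g ≫ N.arrow) ≫ cokernel.π L.arrow = 0 := by simpa using hg
    have h1 : L.Factors (g ≫ N.arrow) :=
      Subobject.factors_iff _ _ |>.2
        ⟨Abelian.monoLift L.arrow (g ≫ N.arrow) hk, Abelian.monoLift_comp L.arrow _ hk⟩
    have h2 : (L ⊓ N).Factors (g ≫ N.arrow) :=
      (Subobject.inf_factors _).2 ⟨h1, Subobject.factors_of_factors_right g N.factors_self⟩
    rw [hLN, Subobject.bot_factors_iff_zero] at h2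
    exact (cancel_mono N.arrow).1 (by rw [h2, zero_comp])
  exact hN (hH.2 L hL N ⟨Subobject.mk (N.arrow ≫ cokernel.π L.arrow),
    ⟨(Subobject.underlyingIso _).symm⟩⟩)

variable (C) in
/-- Atom equivalence as an equivalence relation on the monoform objects of `C`. -/
def atomSetoid : Setoid {H : C // IsMonoform H} where
  r H₁ H₂ := AtomEquiv H₁.1 H₂.1
  iseqv := by
    refine ⟨fun H => ?_, fun {H₁ H₂} h => ?_, fun {H₁ H₂ H₃} h h' => ?_⟩
    · exact (atomEquiv_iff _ _).2 ⟨H.1, 𝟙 _, 𝟙 _, H.2.1, inferInstance, inferInstance⟩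
    · obtain ⟨X, i, j, hX, hi, hj⟩ := (atomEquiv_iff _ _).1 h
      exact (atomEquiv_iff _ _).2 ⟨X, j, i, hX, hj, hi⟩
    · obtain ⟨X, i, j, hX, hi, hj⟩ := (atomEquiv_iff _ _).1 h
      obtain ⟨Y, k, l, hY, hk, hl⟩ := (atomEquiv_iff _ _).1 h'
      have hXb : Subobject.mk j ≠ ⊥ := by
        rw [subobject_ne_bot_iff]
        exact fun hz => hX (hz.of_iso (Subobject.underlyingIso j).symm)
      have hYb : Subobject.mk k ≠ ⊥ := by
        rw [subobject_ne_bot_iff]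
        exact fun hz => hY (hz.of_iso (Subobject.underlyingIso k).symm)
      have hb := H₂.2.inf_ne_bot hXb hYb
      refine (atomEquiv_iff _ _).2 ⟨((Subobject.mk j ⊓ Subobject.mk k : Subobject H₂.1) : C),
        Subobject.ofLE _ _ inf_le_left ≫ (Subobject.underlyingIso j).hom ≫ i,
        Subobject.ofLE _ _ inf_le_right ≫ (Subobject.underlyingIso k).hom ≫ l,
        (subobject_ne_bot_iff _).1 hb, inferInstance, inferInstance⟩

variable (C) in
/-- The atom spectrum: monoform objects modulo atom equivalence. -/
def ASpec : Type w := Quotient (atomSetoid C)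

/-- The atom represented by a monoform object. -/
def ASpec.mk (H : C) (hH : IsMonoform H) : ASpec C := Quotient.mk (atomSetoid C) ⟨H, hH⟩

/-- The atom support of `M`: the atoms represented by the monoform subquotients of `M`. -/
def ASupp (M : C) : Set (ASpec C) :=
  {α | ∃ (H : C) (hH : IsMonoform H), IsSubquotient H M ∧ ASpec.mk H hH = α}

/-- Open subsets of the localizing topology: those of the form `ASupp M`. -/
def IsLocOpen (Φ : Set (ASpec C)) : Prop := ∃ M : C, Φ = ASupp M

/-- Closure with respect to the localizing topology: the intersection of all closed supersets. -/
def locClosure (Φ : Set (ASpec C)) : Set (ASpec C) :=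
  ⋂₀ {Ψ | IsLocOpen Ψᶜ ∧ Φ ⊆ Ψ}

/-- The specialization order: `α ≤ β` if and only if `α` lies in the closure of `{β}`. -/
instance : LE (ASpec C) := ⟨fun α β => α ∈ locClosure {β}⟩

lemma ASpec.le_iff (α β : ASpec C) : α ≤ β ↔ ∀ M : C, α ∈ ASupp M → β ∈ ASupp M := by
  change (∀ Ψ : Set (ASpec C), (IsLocOpen Ψᶜ ∧ {β} ⊆ Ψ) → α ∈ Ψ) ↔ _
  constructor
  · intro h M hα
    by_contra hβ
    exact h (ASupp M)ᶜ ⟨⟨M, compl_compl _⟩, by simpa using hβ⟩ hα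
  · rintro h Ψ ⟨⟨M, hM⟩, hβ⟩
    by_contra hα
    have hβ' : β ∈ Ψᶜ := by
      rw [hM]
      exact h M (hM ▸ hα)
    exact hβ' (hβ rfl)

end Category

/-- `C` is a locally noetherian Grothendieck category: a Grothendieck category with a small
generating family of noetherian objects. -/
structure IsLocallyNoetherianGrothendieck (C : Type w) [Category.{v} C] [Abelian C] : Prop where
  isGrothendieckAbelian : IsGrothendieckAbelian.{v} C
  exists_generators : ∃ P : ObjectProperty C, ObjectProperty.Small.{v} P ∧
    (∀ X, P X → IsNoetherianObject X) ∧ P.IsSeparating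

section WeaklyClosed

variable {C : Type w} [Category.{v} C]

/-- Objects of a weakly closed (prelocalizing) subcategory: closed under subobjects, quotients and
small direct sums. -/
structure IsWeaklyClosed (P : ObjectProperty C) : Prop where
  subobjects : P.IsClosedUnderSubobjects
  quotients : P.IsClosedUnderQuotients
  coproducts : ∀ J : Type v, P.IsClosedUnderColimitsOfShape (Discrete J)

/-- The objects of the smallest weakly closed subcategory containing `M`. -/
def weaklyClosedHull (M : C) : ObjectProperty C :=
  fun X => ∀ P : ObjectProperty C, IsWeaklyClosed P → P M → P X

lemma weaklyClosedHull_self (M : C) : weaklyClosedHull M M := fun _ _ h => h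

lemma isWeaklyClosed_weaklyClosedHull (M : C) : IsWeaklyClosed (weaklyClosedHull M) where
  subobjects := ⟨fun f _ hY P hP hM => hP.subobjects.prop_of_mono f (hY P hP hM)⟩
  quotients := ⟨fun f _ hY P hP hM => hP.quotients.prop_of_epi f (hY P hP hM)⟩
  coproducts J := ⟨by
    rintro X ⟨h⟩ P hP hM
    have := hP.coproducts J
    exact P.prop_of_isColimit h.isColimit fun j => h.prop_diag_obj j P hP hM⟩

instance (M : C) : (weaklyClosedHull M).IsClosedUnderSubobjects :=
  (isWeaklyClosed_weaklyClosedHull M).subobjects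

instance (M : C) : (weaklyClosedHull M).IsClosedUnderQuotients :=
  (isWeaklyClosed_weaklyClosedHull M).quotients

variable [Abelian C]

instance (M : C) : (weaklyClosedHull M).ContainsZero where
  exists_zero := ⟨(⊥_ C), (isZero_zero C).of_iso HasZeroObject.zeroIsoInitial.symm,
    (weaklyClosedHull M).prop_of_mono (initial.to M) (weaklyClosedHull_self M)⟩

instance (M : C) : (weaklyClosedHull M).IsClosedUnderFiniteProducts := by
  refine ObjectProperty.IsClosedUnderFiniteProducts.of_isClosedUnderLimitsOfShape.{v}
    fun J _ => ⟨?_⟩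
  rintro X ⟨h⟩
  have := (isWeaklyClosed_weaklyClosedHull M).coproducts J
  have := Abelian.hasFiniteBiproducts (C := C)
  let F : J → C := fun j => h.diag.obj ⟨j⟩
  have h1 : weaklyClosedHull M (∐ F) :=
    (weaklyClosedHull M).prop_colimit _ fun j => h.prop_diag_obj j
  have e1 : (∐ F) ≅ ⨁ F := (biproduct.isoCoproduct F).symm
  have e2 : (⨁ F) ≅ limit h.diag :=
    biproduct.isoProduct F ≪≫ HasLimit.isoOfNatIso (Discrete.natIso fun _ => Iso.refl _)
  have e3 : X ≅ limit h.diag := h.isLimit.conePointUniqueUpToIso (limit.isLimit _)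
  exact (weaklyClosedHull M).prop_of_iso (e1 ≪≫ e2 ≪≫ e3.symm) h1

end WeaklyClosed

end AtomSpectrum

/-! ### The formal monoid algebra -/

/-- The formal monoid algebra `K⟨⟨C⟩⟩`: arbitrary families of coefficients indexed by the words
in `C`. -/
def FormalMonoidAlgebra (K : Type u) (C : Type u) : Type u := FreeMonoid C → K

namespace FormalMonoidAlgebra

section Coeff

variable {K C : Type u}

/-- The coefficient at a word. -/
def coeff (f : FormalMonoidAlgebra K C) (c : FreeMonoid C) : K := f c

/-- The element with given coefficients. -/
def ofCoeff (f : FreeMonoid C → K) : FormalMonoidAlgebra K C := f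

@[ext] lemma ext {f g : FormalMonoidAlgebra K C} (h : ∀ c, f.coeff c = g.coeff c) : f = g :=
  funext h

@[simp] lemma coeff_ofCoeff (f : FreeMonoid C → K) (c : FreeMonoid C) :
    (ofCoeff f).coeff c = f c := rfl

end Coeff

variable {K : Type u} [Field K] {C : Type u}

instance : AddCommGroup (FormalMonoidAlgebra K C) :=
  inferInstanceAs (AddCommGroup (FreeMonoid C → K))

instance : Module K (FormalMonoidAlgebra K C) :=
  inferInstanceAs (Module K (FreeMonoid C → K))

@[simp] lemma coeff_add (f g : FormalMonoidAlgebra K C) (c : FreeMonoid C) :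
    (f + g).coeff c = f.coeff c + g.coeff c := rfl

@[simp] lemma coeff_zero (c : FreeMonoid C) : (0 : FormalMonoidAlgebra K C).coeff c = 0 := rfl

@[simp] lemma coeff_smul (k : K) (f : FormalMonoidAlgebra K C) (c : FreeMonoid C) :
    (k • f).coeff c = k * f.coeff c := rfl

/-- The empty word. -/
instance : One (FormalMonoidAlgebra K C) :=
  ⟨ofCoeff fun c => if c.toList = [] then 1 else 0⟩

/-- The product: the coefficient at `c` is the sum of `f c₁ * g c₂` over the factorizations
`c = c₁ c₂`, which are the pairs (first `i` letters of `c`, remaining letters of `c`). -/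
instance : Mul (FormalMonoidAlgebra K C) :=
  ⟨fun f g => ofCoeff fun c => ∑ i ∈ Finset.range (c.toList.length + 1),
    f.coeff (FreeMonoid.ofList (c.toList.take i)) * g.coeff (FreeMonoid.ofList (c.toList.drop i))⟩

lemma coeff_one (c : FreeMonoid C) :
    (1 : FormalMonoidAlgebra K C).coeff c = if c.toList = [] then 1 else 0 := rfl

lemma coeff_mul (f g : FormalMonoidAlgebra K C) (c : FreeMonoid C) :
    (f * g).coeff c = ∑ i ∈ Finset.range (c.toList.length + 1),
      f.coeff (FreeMonoid.ofList (c.toList.take i)) *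
        g.coeff (FreeMonoid.ofList (c.toList.drop i)) := rfl

/-- The product as a sum over all factorizations of a word. -/
lemma coeff_mul_eq_finsum (f g : FormalMonoidAlgebra K C) (c : FreeMonoid C) :
    (f * g).coeff c =
      ∑ᶠ p : {p : FreeMonoid C × FreeMonoid C // p.1 * p.2 = c}, f.coeff p.1.1 * g.coeff p.1.2 := by
  let e : Fin (c.toList.length + 1) ≃ {p : FreeMonoid C × FreeMonoid C // p.1 * p.2 = c} :=
    { toFun := fun i => ⟨(FreeMonoid.ofList (c.toList.take i), FreeMonoid.ofList (c.toList.drop i)),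
        by rw [← FreeMonoid.ofList_append, List.take_append_drop, FreeMonoid.ofList_toList]⟩
      invFun := fun p => ⟨p.1.1.toList.length, by
        obtain ⟨⟨a, b⟩, rfl⟩ := p
        simp [FreeMonoid.toList_mul]⟩
      left_inv := by
        intro i
        ext
        simp
        omega
      right_inv := by
        rintro ⟨⟨a, b⟩, rfl⟩
        simp [FreeMonoid.toList_mul] }
  rw [← finsum_comp_equiv e, finsum_eq_sum_of_fintype, coeff_mul, Finset.sum_range]
  rfl

/-- Removal of a prescribed first letter. -/
def tailAt (a : C) (f : FormalMonoidAlgebra K C) : FormalMonoidAlgebra K C :=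
  ofCoeff fun c => f.coeff (FreeMonoid.of a * c)

lemma coeff_mul_nil (f g : FormalMonoidAlgebra K C) :
    (f * g).coeff 1 = f.coeff 1 * g.coeff 1 := by
  simp [coeff_mul]

lemma coeff_mul_cons (f g : FormalMonoidAlgebra K C) (a : C) (c : FreeMonoid C) :
    (f * g).coeff (FreeMonoid.of a * c) =
      f.coeff 1 * g.coeff (FreeMonoid.of a * c) + (tailAt a f * g).coeff c := by
  rw [coeff_mul, coeff_mul]
  have hl : (FreeMonoid.of a * c).toList = a :: c.toList := rfl
  rw [hl, List.length_cons, Finset.sum_range_succ', add_comm]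
  rfl

lemma tailAt_mul (f g : FormalMonoidAlgebra K C) (a : C) :
    tailAt a (f * g) = f.coeff 1 • tailAt a g + tailAt a f * g := by
  ext c
  simp [tailAt, coeff_mul_cons]

lemma add_mul' (f g h : FormalMonoidAlgebra K C) : (f + g) * h = f * h + g * h := by
  ext c
  simp only [coeff_mul, coeff_add, add_mul, Finset.sum_add_distrib]

lemma mul_add' (f g h : FormalMonoidAlgebra K C) : f * (g + h) = f * g + f * h := by
  ext c
  simp only [coeff_mul, coeff_add, mul_add, Finset.sum_add_distrib]

lemma smul_mul' (k : K) (f g : FormalMonoidAlgebra K C) : (k • f) * g = k • (f * g) := by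
  ext c
  simp only [coeff_mul, coeff_smul, Finset.mul_sum, mul_assoc]

lemma mul_smul' (k : K) (f g : FormalMonoidAlgebra K C) : f * (k • g) = k • (f * g) := by
  ext c
  simp only [coeff_mul, coeff_smul, Finset.mul_sum, mul_left_comm]

lemma mul_assoc' (f g h : FormalMonoidAlgebra K C) : f * g * h = f * (g * h) := by
  ext c
  induction c using FreeMonoid.recOn generalizing f with
  | one => simp only [coeff_mul_nil, mul_assoc]
  | of_mul a c ih =>
    rw [coeff_mul_cons, coeff_mul_cons, coeff_mul_nil, tailAt_mul, add_mul', smul_mul', coeff_add,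
      coeff_smul, ih, coeff_mul_cons]
    ring

lemma one_mul' (f : FormalMonoidAlgebra K C) : 1 * f = f := by
  ext c
  induction c using FreeMonoid.recOn with
  | one => simp [coeff_mul_nil, coeff_one]
  | of_mul a c ih =>
    have h0 : tailAt a (1 : FormalMonoidAlgebra K C) = 0 := by
      ext d
      simp [tailAt, coeff_one]
    rw [coeff_mul_cons, h0]
    simp [coeff_one, coeff_mul]

lemma mul_one' (f : FormalMonoidAlgebra K C) : f * 1 = f := by
  ext c
  induction c using FreeMonoid.recOn generalizing f with
  | one => simp [coeff_mul_nil, coeff_one]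
  | of_mul a c ih =>
    rw [coeff_mul_cons, ih]
    simp [coeff_one, tailAt]

instance : Ring (FormalMonoidAlgebra K C) :=
  { (inferInstance : AddCommGroup (FormalMonoidAlgebra K C)),
    (inferInstance : Mul (FormalMonoidAlgebra K C)),
    (inferInstance : One (FormalMonoidAlgebra K C)) with
    left_distrib := mul_add'
    right_distrib := add_mul'
    zero_mul := fun f => by ext c; simp [coeff_mul]
    mul_zero := fun f => by ext c; simp [coeff_mul]
    mul_assoc := mul_assoc'
    one_mul := one_mul'
    mul_one := mul_one' }

instance : Algebra K (FormalMonoidAlgebra K C) :=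
  Algebra.ofModule smul_mul' mul_smul'

/-- The support: the words with nonzero coefficient. -/
def supp (f : FormalMonoidAlgebra K C) : Set (FreeMonoid C) := {c | f.coeff c ≠ 0}

end FormalMonoidAlgebra

/-! ### Colored quivers -/

/-- A colored quiver: vertices, arrows and colors, with source, target and color of each arrow. -/
structure ColoredQuiver where
  /-- vertices -/
  V : Type u
  /-- arrows -/
  A : Type u
  /-- colors -/
  C : Type u
  /-- source of an arrow -/
  src : A → V
  /-- target of an arrow -/
  tgt : A → V
  /-- color of an arrow -/
  color : A → C

namespace ColoredQuiver

section Paths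

variable (Γ : ColoredQuiver.{u})

/-- The underlying quiver; the arrows `v ⟶ w` are the arrows with source `v` and target `w`. -/
instance toQuiver : Quiver.{u} Γ.V := ⟨fun v w => {r : Γ.A // Γ.src r = v ∧ Γ.tgt r = w}⟩

/-- The arrow of `Γ` underlying a morphism of the underlying quiver. -/
def arrow {v w : Γ.V} (e : v ⟶ w) : Γ.A :=
  Subtype.val (p := fun r : Γ.A => Γ.src r = v ∧ Γ.tgt r = w) e

/-- The sequence of colors of a path. -/
def pathColor {v w : Γ.V} (r : Quiver.Path v w) : FreeMonoid Γ.C :=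
  Quiver.Path.weight (fun {_ _ : Γ.V} e => FreeMonoid.of (Γ.color (Γ.arrow e))) r

/-- The paths with target `v`, each recorded together with its source. -/
abbrev PathTo (v : Γ.V) : Type u := Σ w : Γ.V, Quiver.Path w v

/-- The set `P_v(B)` of paths with target `v` and sequence of colors in `B`. -/
def pathsTo (v : Γ.V) (B : Set (FreeMonoid Γ.C)) : Set (Γ.PathTo v) :=
  {r | Γ.pathColor r.2 ∈ B}

variable {Γ}

@[simp] lemma pathColor_nil (v : Γ.V) : Γ.pathColor (Quiver.Path.nil : Quiver.Path v v) = 1 :=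
  Quiver.Path.weight_nil _ _

lemma pathColor_comp {a b c : Γ.V} (p : Quiver.Path a b) (q : Quiver.Path b c) :
    Γ.pathColor (p.comp q) = Γ.pathColor p * Γ.pathColor q :=
  Quiver.Path.weight_comp _ _ _

lemma length_pathColor {a b : Γ.V} (p : Quiver.Path a b) :
    (Γ.pathColor p).toList.length = p.length := by
  induction p with
  | nil => rw [pathColor_nil]; rfl
  | cons p e ih =>
    have h : Γ.pathColor (p.cons e) = Γ.pathColor p * FreeMonoid.of (Γ.color (Γ.arrow e)) :=
      Quiver.Path.weight_cons _ _ _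
    rw [h, FreeMonoid.toList_mul, List.length_append, ih]
    rfl

end Paths

section Algebra

variable (K : Type u) [Field K] (Γ : ColoredQuiver.{u})

/-- Admissible elements of the formal monoid algebra. -/
def IsAdmissible {K : Type u} [Field K] (f : FormalMonoidAlgebra K Γ.C) : Prop :=
  ∀ v : Γ.V, (Γ.pathsTo v f.supp).Finite

variable {K Γ}

/-- The coefficient of a product at the color sequence of a path is the sum over all
decompositions of the path. -/
lemma coeff_mul_pathColor (f g : FormalMonoidAlgebra K Γ.C) {a v : Γ.V} (r : Quiver.Path a v) :
    (f * g).coeff (Γ.pathColor r) =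
      ∑ᶠ s : {s : Σ b : Γ.V, Quiver.Path a b × Quiver.Path b v // s.2.1.comp s.2.2 = r},
        f.coeff (Γ.pathColor s.1.2.1) * g.coeff (Γ.pathColor s.1.2.2) := by
  let S := {s : Σ b : Γ.V, Quiver.Path a b × Quiver.Path b v // s.2.1.comp s.2.2 = r}
  let φ : S → Fin (r.length + 1) := fun s => ⟨s.1.2.1.length, by
    have h := congrArg Quiver.Path.length s.2
    rw [Quiver.Path.length_comp] at h
    omega⟩
  have hφ : Function.Bijective φ := by
    constructor
    · rintro ⟨⟨b, p, q⟩, h⟩ ⟨⟨b', p', q'⟩, h'⟩ hs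
      have hl : p.length = p'.length := congrArg Fin.val hs
      have hh : p.comp q = p'.comp q' := h.trans h'.symm
      have hv : b = b' := by
        have hlt : p.length < (p.comp q).vertices.length := by
          rw [Quiver.Path.vertices_length, Quiver.Path.length_comp]
          omega
        have e1 := Quiver.Path.vertices_comp_get_length_eq p q hlt
        have hlt' : p'.length < (p'.comp q').vertices.length := by
          rw [Quiver.Path.vertices_length, Quiver.Path.length_comp]
          omega
        have e2 := Quiver.Path.vertices_comp_get_length_eq p' q' hlt'
        have hget : ∀ (l l' : List Γ.V) (n n' : ℕ) (hn : n < l.length) (hn' : n' < l'.length),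
            l = l' → n = n' → l.get ⟨n, hn⟩ = l'.get ⟨n', hn'⟩ := by
          rintro _ _ _ _ _ _ rfl rfl
          rfl
        rw [← e1, ← e2]
        exact hget _ _ _ _ _ _ (by rw [hh]) hl
      subst hv
      obtain ⟨rfl, rfl⟩ := (Quiver.Path.comp_inj' hl).1 hh
      rfl
    · intro i
      obtain ⟨b, p, q, hpq, hl⟩ := r.exists_eq_comp_of_le_length (Nat.lt_succ_iff.1 i.2)
      exact ⟨⟨⟨b, p, q⟩, hpq.symm⟩, Fin.ext hl⟩
  rw [FormalMonoidAlgebra.coeff_mul, length_pathColor, Finset.sum_range,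
    ← finsum_eq_sum_of_fintype]
  refine (finsum_eq_of_bijective φ hφ ?_).symm
  rintro ⟨⟨b, p, q⟩, rfl⟩
  have hl : (Γ.pathColor p).toList.length = p.length := length_pathColor p
  have h1 : (Γ.pathColor (p.comp q)).toList = (Γ.pathColor p).toList ++ (Γ.pathColor q).toList := by
    rw [pathColor_comp, FreeMonoid.toList_mul]
  simp only [φ, h1, ← hl, List.take_left, List.drop_left, FreeMonoid.ofList_toList]

lemma finite_comp {v : Γ.V} {A : Set (Γ.PathTo v)} (hA : A.Finite)
    (B : ∀ w : Γ.V, Set (Γ.PathTo w)) (hB : ∀ w, (B w).Finite) :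
    {r : Γ.PathTo v | ∃ q ∈ A, ∃ p ∈ B q.1, r = ⟨p.1, p.2.comp q.2⟩}.Finite := by
  refine (hA.biUnion fun q _ => (hB q.1).image
    fun p => (⟨p.1, p.2.comp q.2⟩ : Γ.PathTo v)).subset ?_
  rintro r ⟨q, hq, p, hp, rfl⟩
  exact Set.mem_biUnion hq ⟨p, hp, rfl⟩

/-- A path carrying a nonzero coefficient of a product decomposes accordingly. -/
lemma exists_comp_of_mem_supp_mul (f g : FormalMonoidAlgebra K Γ.C) {v : Γ.V} (r : Γ.PathTo v)
    (hr : r ∈ Γ.pathsTo v (f * g).supp) :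
    ∃ q ∈ Γ.pathsTo v g.supp, ∃ p ∈ Γ.pathsTo q.1 f.supp, r = ⟨p.1, p.2.comp q.2⟩ := by
  obtain ⟨a, r⟩ := r
  have hr' : (f * g).coeff (Γ.pathColor r) ≠ 0 := hr
  rw [coeff_mul_pathColor] at hr'
  obtain ⟨⟨⟨b, p, q⟩, hs⟩, hne⟩ := not_forall.1 fun h => hr' (finsum_eq_zero_of_forall_eq_zero h)
  exact ⟨⟨b, q⟩, right_ne_zero_of_mul hne, ⟨a, p⟩, left_ne_zero_of_mul hne, by simp [← hs]⟩

variable (K Γ)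

/-- The algebra `F_Γ` of admissible elements. -/
def admissibleAlgebra : Subalgebra K (FormalMonoidAlgebra K Γ.C) where
  carrier := {f | Γ.IsAdmissible f}
  add_mem' := by
    intro f g hf hg v
    refine ((hf v).union (hg v)).subset fun r hr => ?_
    by_contra h
    have h' : ¬ (f.coeff (Γ.pathColor r.2) ≠ 0 ∨ g.coeff (Γ.pathColor r.2) ≠ 0) := h
    push Not at h'
    exact hr (by rw [FormalMonoidAlgebra.coeff_add, h'.1, h'.2, add_zero])
  mul_mem' := by
    intro f g hf hg v
    exact (finite_comp (hg v) (fun w => Γ.pathsTo w f.supp) hf).subset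
      fun r hr => exists_comp_of_mem_supp_mul f g r hr
  algebraMap_mem' := by
    intro k v
    refine (Set.finite_singleton (⟨v, Quiver.Path.nil⟩ : Γ.PathTo v)).subset ?_
    rintro ⟨a, r⟩ hr
    have hr' : (algebraMap K (FormalMonoidAlgebra K Γ.C) k).coeff (Γ.pathColor r) ≠ 0 := hr
    rw [Algebra.algebraMap_eq_smul_one, FormalMonoidAlgebra.coeff_smul,
      FormalMonoidAlgebra.coeff_one] at hr'
    have h1 : (Γ.pathColor r).toList = [] := by
      by_contra h
      simp [h] at hr'
    have h2 : r.length = 0 := by rw [← length_pathColor, h1]; rfl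
    obtain rfl := Quiver.Path.eq_of_length_zero r h2
    rw [Quiver.Path.eq_nil_of_length_zero r h2]
    rfl

/-- The vector space underlying `M_Γ`: families of scalars indexed by the vertices. -/
def VertexModule : Type u := Γ.V → K

instance : AddCommGroup (Γ.VertexModule K) := inferInstanceAs (AddCommGroup (Γ.V → K))

variable {K Γ}

/-- The right action: the coefficient of `y f` at `v` is the sum, over the paths `r` with target
`v`, of the coefficient of `f` at the color sequence of `r` times that of `y` at the source. -/
noncomputable def rightAct (y : Γ.VertexModule K) (f : FormalMonoidAlgebra K Γ.C) :
    Γ.VertexModule K :=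
  fun v => ∑ᶠ r : Γ.PathTo v, f.coeff (Γ.pathColor r.2) * y r.1

lemma rightAct_eq_sum (y : Γ.VertexModule K) (f : FormalMonoidAlgebra K Γ.C) (v : Γ.V)
    (s : Finset (Γ.PathTo v)) (hs : Γ.pathsTo v f.supp ⊆ s) :
    rightAct y f v = ∑ r ∈ s, f.coeff (Γ.pathColor r.2) * y r.1 := by
  refine finsum_eq_sum_of_support_subset _ fun r hr => hs ?_
  exact left_ne_zero_of_mul hr

lemma rightAct_add (y z : Γ.VertexModule K) (f : FormalMonoidAlgebra K Γ.C)
    (hf : Γ.IsAdmissible f) : rightAct (y + z) f = rightAct y f + rightAct z f := by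
  funext v
  change _ = rightAct y f v + rightAct z f v
  simp only [rightAct_eq_sum _ f v (hf v).toFinset (by simp)]
  rw [← Finset.sum_add_distrib]
  exact Finset.sum_congr rfl fun r _ => mul_add _ _ _

lemma rightAct_zero (f : FormalMonoidAlgebra K Γ.C) :
    rightAct (0 : Γ.VertexModule K) f = 0 := by
  funext v
  change ∑ᶠ r : Γ.PathTo v, f.coeff (Γ.pathColor r.2) * (0 : K) = 0
  simp

lemma rightAct_add_right (y : Γ.VertexModule K) (f g : FormalMonoidAlgebra K Γ.C)
    (hf : Γ.IsAdmissible f) (hg : Γ.IsAdmissible g) :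
    rightAct y (f + g) = rightAct y f + rightAct y g := by
  classical
  funext v
  change _ = rightAct y f v + rightAct y g v
  have h1 : Γ.pathsTo v f.supp ⊆ ((hf v).toFinset ∪ (hg v).toFinset : Finset (Γ.PathTo v)) := by
    intro r hr; simp [hr]
  have h2 : Γ.pathsTo v g.supp ⊆ ((hf v).toFinset ∪ (hg v).toFinset : Finset (Γ.PathTo v)) := by
    intro r hr; simp [hr]
  have h3 : Γ.pathsTo v (f + g).supp ⊆
      ((hf v).toFinset ∪ (hg v).toFinset : Finset (Γ.PathTo v)) := by
    intro r hr
    by_contra h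
    have hfr : f.coeff (Γ.pathColor r.2) = 0 := by
      by_contra h'
      exact h (h1 h')
    have hgr : g.coeff (Γ.pathColor r.2) = 0 := by
      by_contra h'
      exact h (h2 h')
    exact hr (by rw [FormalMonoidAlgebra.coeff_add, hfr, hgr, add_zero])
  rw [rightAct_eq_sum _ _ v _ h1, rightAct_eq_sum _ _ v _ h2, rightAct_eq_sum _ _ v _ h3,
    ← Finset.sum_add_distrib]
  exact Finset.sum_congr rfl fun r _ => add_mul _ _ _

lemma rightAct_zero_right (y : Γ.VertexModule K) :
    rightAct y (0 : FormalMonoidAlgebra K Γ.C) = 0 := by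
  funext v
  change ∑ᶠ r : Γ.PathTo v, (0 : K) * y r.1 = 0
  simp

lemma rightAct_one (y : Γ.VertexModule K) : rightAct y (1 : FormalMonoidAlgebra K Γ.C) = y := by
  funext v
  rw [rightAct_eq_sum y 1 v {⟨v, Quiver.Path.nil⟩}]
  · simp [FormalMonoidAlgebra.coeff_one]
  · rintro ⟨a, r⟩ hr
    have hr' : (1 : FormalMonoidAlgebra K Γ.C).coeff (Γ.pathColor r) ≠ 0 := hr
    rw [FormalMonoidAlgebra.coeff_one] at hr'
    have h1 : (Γ.pathColor r).toList = [] := by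
      by_contra h
      simp [h] at hr'
    have h2 : r.length = 0 := by rw [← length_pathColor, h1]; rfl
    obtain rfl := Quiver.Path.eq_of_length_zero r h2
    rw [Quiver.Path.eq_nil_of_length_zero r h2]
    simp

lemma rightAct_mul (y : Γ.VertexModule K) (f g : FormalMonoidAlgebra K Γ.C)
    (hf : Γ.IsAdmissible f) (hg : Γ.IsAdmissible g) :
    rightAct y (f * g) = rightAct (rightAct y f) g := by
  classical
  funext v
  let T : Finset (Σ q : Γ.PathTo v, Γ.PathTo q.1) :=
    (hg v).toFinset.sigma fun q => (hf q.1).toFinset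
  let κ : (Σ q : Γ.PathTo v, Γ.PathTo q.1) → Γ.PathTo v := fun t => ⟨t.2.1, t.2.2.comp t.1.2⟩
  have hR : rightAct (rightAct y f) g v = ∑ t ∈ T, g.coeff (Γ.pathColor t.1.2) *
      (f.coeff (Γ.pathColor t.2.2) * y t.2.1) := by
    rw [rightAct_eq_sum _ g v (hg v).toFinset (by simp), Finset.sum_sigma]
    refine Finset.sum_congr rfl fun q _ => ?_
    rw [rightAct_eq_sum _ f q.1 (hf q.1).toFinset (by simp), Finset.mul_sum]
  have hL := rightAct_eq_sum y (f * g) v (T.image κ) (by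
    intro r hr
    obtain ⟨q, hq, p, hp, rfl⟩ := exists_comp_of_mem_supp_mul f g r hr
    exact Finset.mem_coe.2 (Finset.mem_image.2 ⟨⟨q, p⟩, by simp [T, hq, hp], rfl⟩))
  rw [hL, hR, ← Finset.sum_fiberwise_of_maps_to (t := T.image κ) (g := κ)
    fun t ht => Finset.mem_image_of_mem κ ht]
  refine Finset.sum_congr rfl ?_
  rintro ⟨a, r⟩ -
  have hc : (f * g).coeff (Γ.pathColor r) = ∑ t ∈ T with κ t = ⟨a, r⟩,
      f.coeff (Γ.pathColor t.2.2) * g.coeff (Γ.pathColor t.1.2) := by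
    let φ : {s : Σ b : Γ.V, Quiver.Path a b × Quiver.Path b v // s.2.1.comp s.2.2 = r} →
        {t : Σ q : Γ.PathTo v, Γ.PathTo q.1 // κ t = ⟨a, r⟩} :=
      fun s => ⟨⟨⟨s.1.1, s.1.2.2⟩, ⟨a, s.1.2.1⟩⟩, by simp [κ, s.2]⟩
    have hφ : Function.Bijective φ := by
      constructor
      · rintro ⟨⟨b, p, q⟩, h⟩ ⟨⟨b', p', q'⟩, h'⟩ hs
        have hs' := congrArg Subtype.val hs
        simp only [φ, Sigma.mk.injEq] at hs'
        obtain ⟨⟨rfl, h1⟩, h2⟩ := hs'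
        obtain rfl := eq_of_heq h1
        have h3 := eq_of_heq h2
        simp only [Sigma.mk.injEq, heq_eq_eq, true_and] at h3
        subst h3
        rfl
      · rintro ⟨⟨⟨b, q⟩, ⟨a', p⟩⟩, ht⟩
        obtain ⟨rfl, h2⟩ := Sigma.mk.inj_iff.1 ht
        exact ⟨⟨⟨b, p, q⟩, eq_of_heq h2⟩, rfl⟩
    rw [coeff_mul_pathColor]
    trans ∑ᶠ t : {t : Σ q : Γ.PathTo v, Γ.PathTo q.1 // κ t = ⟨a, r⟩},
      f.coeff (Γ.pathColor t.1.2.2) * g.coeff (Γ.pathColor t.1.1.2)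
    · exact finsum_eq_of_bijective φ hφ fun s => rfl
    · rw [finsum_subtype_eq_finsum_cond (f := fun t : Σ q : Γ.PathTo v, Γ.PathTo q.1 =>
        f.coeff (Γ.pathColor t.2.2) * g.coeff (Γ.pathColor t.1.2)) (fun t => κ t = ⟨a, r⟩)]
      refine finsum_cond_eq_sum_of_cond_iff _ fun {t} ht => ?_
      have h1 := left_ne_zero_of_mul ht
      have h2 := right_ne_zero_of_mul ht
      have h3 : t ∈ T := by
        rw [Finset.mem_sigma]
        exact ⟨(hg v).mem_toFinset.2 h2, (hf t.1.1).mem_toFinset.2 h1⟩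
      simp [h3]
  rw [hc, Finset.sum_mul]
  refine Finset.sum_congr rfl ?_
  rintro ⟨⟨b, q⟩, ⟨a', p⟩⟩ ht
  obtain ⟨rfl, -⟩ := Sigma.mk.inj_iff.1 (Finset.mem_filter.1 ht).2
  change _ * _ * y a' = _ * (_ * y a')
  ring

/-- `M_Γ` as a right `F_Γ`-module, i.e. a left module over the opposite algebra. -/
noncomputable instance : Module (Γ.admissibleAlgebra K)ᵐᵒᵖ (Γ.VertexModule K) where
  smul f y := rightAct y f.unop.1
  one_smul := rightAct_one
  mul_smul f g y := rightAct_mul y g.unop.1 f.unop.1 g.unop.2 f.unop.2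
  smul_zero f := rightAct_zero f.unop.1
  smul_add f y z := rightAct_add y z f.unop.1 f.unop.2
  add_smul f g y := rightAct_add_right y f.unop.1 g.unop.1 f.unop.2 g.unop.2
  zero_smul := rightAct_zero_right

lemma op_smul_apply (f : Γ.admissibleAlgebra K) (y : Γ.VertexModule K) (v : Γ.V) :
    (MulOpposite.op f • y) v = ∑ᶠ r : Γ.PathTo v, f.1.coeff (Γ.pathColor r.2) * y r.1 := rfl

variable (K Γ)

/-- The category `Mod F_Γ` of right `F_Γ`-modules. -/
abbrev RightModules : Type (u + 1) := ModuleCat.{u} (Γ.admissibleAlgebra K)ᵐᵒᵖ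

/-- `M_Γ` as an object of `Mod F_Γ`. -/
noncomputable def vertexModuleObj : Γ.RightModules K := ModuleCat.of _ (Γ.VertexModule K)

/-- The category `G_Γ`: the smallest weakly closed subcategory of `Mod F_Γ` containing `M_Γ`. -/
abbrev AssociatedCategory : Type (u + 1) :=
  (AtomSpectrum.weaklyClosedHull (Γ.vertexModuleObj K)).FullSubcategory

/-- `M_Γ` as an object of `G_Γ`. -/
noncomputable def vertexObj : Γ.AssociatedCategory K :=
  ⟨Γ.vertexModuleObj K, AtomSpectrum.weaklyClosedHull_self _⟩

end Algebra

end ColoredQuiver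

/-! The quiver is assembled from blocks. For a maximal `p` the block is one vertex with a loop. For
any other `p` it has countably many layers, each a disjoint union of copies of the blocks of all
`q > p`, and for any two positions `a`, `b` in a layer there is a color whose arrows lead from `a` in
each layer to `b` in the next one (`PosetQuiver.quiver`). The vertex module is the direct sum of the
modules `M p` of functions on the blocks.

For non-maximal `p`, shifting by one layer embeds `M p` into itself, and the cokernel is the direct
sum of the `M q` with `q > p`. The colors between consecutive layers, together with division of
power series, show that each nonzero element of `M p` generates all functions supported on
sufficiently high layers (`PosetQuiver.exists_range_pow_le`). Hence every nonzero submodule of `M p`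
contains a copy of `M p`, and every proper quotient of `M p` belongs to each Serre class containing
the `M q` with `q > p` (`CompressibleFamily.quotient_mem`). Downward induction on `p` gives that
`M p` is noetherian and that every nonzero subquotient of `M p` contains a copy of some `M q`. The
latter property passes to the weakly closed hull because it can be checked on cyclic submodules and
is a Serre condition (`IsSerreClass.span_of_weaklyClosedHull`).

A color of `p` kills `M q` unless `q ≤ p`, but it is not nilpotent on `M p`. Therefore no nonzero
submodule of `M p` embeds into a proper quotient, so `M p` is monoform, and `M p` is a subquotient of
`M q` exactly if `q ≤ p`. So the atoms of the hull are the atoms of the `M p`, ordered like the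
partially ordered set.
-/

/-! ### Weakly closed subcategories are Grothendieck categories -/

namespace AtomSpectrum

section Inclusion

variable {C : Type w} [Category.{v} C] [Abelian C] (M : C)

instance : PreservesFiniteLimits (weaklyClosedHull M).ι :=
  have := ObjectProperty.preservesKernels_ι (weaklyClosedHull M)
  Functor.preservesFiniteLimits_of_preservesKernels _

instance : PreservesFiniteColimits (weaklyClosedHull M).ι :=
  have := ObjectProperty.preservesCokernels_ι (weaklyClosedHull M)
  Functor.preservesFiniteColimits_of_preservesCokernels _

instance {X Y : (weaklyClosedHull M).FullSubcategory} (f : X ⟶ Y) [Mono f] : Mono f.hom :=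
  inferInstanceAs (Mono ((weaklyClosedHull M).ι.map f))

instance {X Y : (weaklyClosedHull M).FullSubcategory} (f : X ⟶ Y) [Epi f] : Epi f.hom :=
  inferInstanceAs (Epi ((weaklyClosedHull M).ι.map f))

/-- Closure under quotients and coproducts gives closure under all small colimits: a colimit is a
quotient of the coproduct of the terms of the diagram. -/
instance [HasCoproducts.{v} C] (J : Type v) [SmallCategory J] :
    (weaklyClosedHull M).IsClosedUnderColimitsOfShape J := ⟨by
  rintro X ⟨h⟩
  have := (isWeaklyClosed_weaklyClosedHull M).coproducts J
  have h1 : weaklyClosedHull M (∐ h.diag.obj) :=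
    (weaklyClosedHull M).prop_colimit _ fun j => h.prop_diag_obj j.as
  let p : (∐ h.diag.obj) ⟶ X := Sigma.desc h.ι.app
  have : Epi p := by
    refine ⟨fun {Z} f g hfg => h.isColimit.hom_ext fun j => ?_⟩
    have := Sigma.ι h.diag.obj j ≫= hfg
    simpa [p] using this
  exact (weaklyClosedHull M).prop_of_epi p h1⟩

/-- A weakly closed subcategory of a category with exact filtered colimits and coproducts is a
Grothendieck category as soon as it has a small separating family. -/
lemma isGrothendieckAbelian_of_isSeparating [HasColimitsOfSize.{v, v} C] [AB5OfSize.{v, v} C]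
    {ι : Type v} (G : ι → (weaklyClosedHull M).FullSubcategory)
    (hG : (ObjectProperty.ofObj G).IsSeparating) :
    IsGrothendieckAbelian.{v} (weaklyClosedHull M).FullSubcategory where
  hasFilteredColimitsOfSize := ⟨fun _ _ _ => inferInstance⟩
  ab5OfSize :=
    have : HasFilteredColimitsOfSize.{v, v} (weaklyClosedHull M).FullSubcategory :=
      ⟨fun _ _ _ => inferInstance⟩
    ⟨fun J _ _ => HasExactColimitsOfShape.domain_of_functor J (weaklyClosedHull M).ι⟩
  hasSeparator :=
    have : HasCoproduct G := HasColimitsOfShape.has_colimit _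
    ⟨⟨∐ G, hG.isSeparator_coproduct⟩⟩

end Inclusion

/-- Compressibility in terms of monomorphisms. -/
lemma isCompressible_of_mono {C : Type w} [Category.{v} C] [Abelian C] {H : C} (h0 : ¬ IsZero H)
    (h : ∀ (X : C) (i : X ⟶ H), ¬ IsZero X → Mono i → ∃ k : H ⟶ X, Mono k) :
    IsCompressible H := by
  refine ⟨h0, fun L hL => ?_⟩
  obtain ⟨k, hk⟩ := h L L.arrow ((subobject_ne_bot_iff L).1 hL) inferInstance
  exact ⟨Subobject.mk (k ≫ L.arrow), Subobject.mk_le_of_comm k rfl, ⟨Subobject.underlyingIso _⟩⟩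

section Module

variable {R : Type u} [Ring R] {M : ModuleCat.{u} R}

lemma injective_of_mono {X Y : (weaklyClosedHull M).FullSubcategory} (f : X ⟶ Y) [Mono f] :
    Function.Injective f.hom.hom :=
  (ModuleCat.mono_iff_injective f.hom).1 inferInstance

lemma surjective_of_epi {X Y : (weaklyClosedHull M).FullSubcategory} (f : X ⟶ Y) [Epi f] :
    Function.Surjective f.hom.hom :=
  (ModuleCat.epi_iff_surjective f.hom).1 inferInstance

lemma exists_mono_of_injective {X Y : (weaklyClosedHull M).FullSubcategory}
    (f : X.obj →ₗ[R] Y.obj) (hf : Function.Injective f) :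
    ∃ g : X ⟶ Y, Mono g ∧ g.hom.hom = f := by
  have : Mono (ModuleCat.ofHom f) := (ModuleCat.mono_iff_injective _).2 hf
  exact ⟨ObjectProperty.homMk (ModuleCat.ofHom f),
    (weaklyClosedHull M).ι.mono_of_mono_map (f := ObjectProperty.homMk (ModuleCat.ofHom f)) this,
    rfl⟩

lemma exists_epi_of_surjective {X Y : (weaklyClosedHull M).FullSubcategory}
    (f : X.obj →ₗ[R] Y.obj) (hf : Function.Surjective f) :
    ∃ g : X ⟶ Y, Epi g ∧ g.hom.hom = f := by
  have : Epi (ModuleCat.ofHom f) := (ModuleCat.epi_iff_surjective _).2 hf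
  exact ⟨ObjectProperty.homMk (ModuleCat.ofHom f),
    (weaklyClosedHull M).ι.epi_of_epi_map (f := ObjectProperty.homMk (ModuleCat.ofHom f)) this,
    rfl⟩

lemma isZero_iff_forall_eq_zero (X : (weaklyClosedHull M).FullSubcategory) :
    IsZero X ↔ ∀ x : X.obj, x = 0 := by
  rw [IsZero.iff_id_eq_zero]
  constructor
  · intro h x
    have : (𝟙 X : X ⟶ X).hom.hom x = (0 : X ⟶ X).hom.hom x := by rw [h]
    exact this
  · intro h
    ext x
    exact (h _).trans (h _).symm

lemma weaklyClosedHull_of_injective (X : (weaklyClosedHull M).FullSubcategory) {A : Type u}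
    [AddCommGroup A] [Module R A] (f : A →ₗ[R] X.obj) (hf : Function.Injective f) :
    weaklyClosedHull M (ModuleCat.of R A) :=
  have : Mono (ModuleCat.ofHom f) := (ModuleCat.mono_iff_injective _).2 hf
  (weaklyClosedHull M).prop_of_mono (ModuleCat.ofHom f) X.2

lemma weaklyClosedHull_of_surjective (X : (weaklyClosedHull M).FullSubcategory) {A : Type u}
    [AddCommGroup A] [Module R A] (f : X.obj →ₗ[R] A) (hf : Function.Surjective f) :
    weaklyClosedHull M (ModuleCat.of R A) :=
  have : Epi (ModuleCat.ofHom f) := (ModuleCat.epi_iff_surjective _).2 hf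
  (weaklyClosedHull M).prop_of_epi (ModuleCat.ofHom f) X.2

/-- An object whose underlying module is noetherian is a noetherian object. -/
lemma isNoetherianObject_of_isNoetherian (X : (weaklyClosedHull M).FullSubcategory)
    [IsNoetherian R X.obj] : IsNoetherianObject X := by
  rw [isNoetherianObject_iff_not_strictMono]
  intro f hf
  have hmono : Monotone fun n => LinearMap.range (f n).arrow.hom.hom := by
    intro a b hab
    rintro _ ⟨x, rfl⟩
    refine ⟨((f a).ofLE (f b) (hf.monotone hab)).hom.hom x, ?_⟩
    have := Subobject.ofLE_arrow (hf.monotone hab)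
    exact congrArg (fun g : (f a : (weaklyClosedHull M).FullSubcategory) ⟶ X => g.hom.hom x) this
  obtain ⟨n, hn⟩ := monotone_stabilizes_iff_noetherian.2 ‹IsNoetherian R X.obj› ⟨_, hmono⟩
  have he : LinearMap.range (f n).arrow.hom.hom = LinearMap.range (f (n + 1)).arrow.hom.hom :=
    hn (n + 1) (Nat.le_succ n)
  have hinj := injective_of_mono (f n).arrow
  let e := LinearEquiv.ofInjective _ hinj
  have hle : f (n + 1) ≤ f n := by
    let g : ((f (n + 1) : (weaklyClosedHull M).FullSubcategory)).obj →ₗ[R]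
        ((f n : (weaklyClosedHull M).FullSubcategory)).obj :=
      e.symm.toLinearMap ∘ₗ LinearMap.codRestrict _ (f (n + 1)).arrow.hom.hom
        fun x => he ▸ LinearMap.mem_range_self _ x
    refine Subobject.le_of_comm (ObjectProperty.homMk (ModuleCat.ofHom g)) ?_
    ext x
    exact congrArg Subtype.val (e.apply_symm_apply _)
  exact absurd (hf (Nat.lt_succ_self n)) (not_lt_of_ge hle)

/-- If the cyclic submodules of all objects are noetherian, then the category is a locally
noetherian Grothendieck category: the cyclic modules in it form a small generating family. -/
lemma isLocallyNoetherianGrothendieck_of_cyclic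
    (h : ∀ (X : (weaklyClosedHull M).FullSubcategory) (x : X.obj),
      IsNoetherian R (Submodule.span R {x})) :
    IsLocallyNoetherianGrothendieck (weaklyClosedHull M).FullSubcategory := by
  let ι : Type u := {I : Submodule R R // weaklyClosedHull M (ModuleCat.of R (R ⧸ I)) ∧
    IsNoetherian R (R ⧸ I)}
  let G : ι → (weaklyClosedHull M).FullSubcategory := fun I => ⟨ModuleCat.of R (R ⧸ I.1), I.2.1⟩
  have hG : (ObjectProperty.ofObj G).IsSeparating := by
    intro X Y f g hfg
    ext x
    let t := LinearMap.toSpanSingleton R X.obj x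
    let e := t.quotKerEquivRange
    have hr : LinearMap.range t = Submodule.span R {x} := LinearMap.range_toSpanSingleton x
    let j : (R ⧸ LinearMap.ker t) →ₗ[R] X.obj := (LinearMap.range t).subtype ∘ₗ e.toLinearMap
    have hj : Function.Injective j := Subtype.val_injective.comp e.injective
    have hn : IsNoetherian R (R ⧸ LinearMap.ker t) := by
      have := h X x
      rw [← hr] at this
      exact isNoetherian_of_linearEquiv e.symm
    let I : ι := ⟨LinearMap.ker t, weaklyClosedHull_of_injective X j hj, hn⟩
    have := hfg (G I) (ObjectProperty.ofObj_apply G I) (ObjectProperty.homMk (ModuleCat.ofHom j))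
    have h2 := congrArg (fun k : G I ⟶ Y => k.hom.hom (Submodule.Quotient.mk 1)) this
    have h3 : j (Submodule.Quotient.mk 1) = x := by
      change t 1 = x
      simp [t]
    change f.hom.hom (j _) = g.hom.hom (j _) at h2
    rwa [h3] at h2
  refine ⟨isGrothendieckAbelian_of_isSeparating M G hG, ObjectProperty.ofObj G, inferInstance,
    ?_, hG⟩
  rintro _ ⟨I⟩
  have : IsNoetherian R (G I).obj := I.2.2
  exact isNoetherianObject_of_isNoetherian (G I)

end Module

end AtomSpectrum

/-! ### Serre classes of modules -/

section SerreClass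

variable {R : Type u} [Ring R]

/-- A Serre class of modules: an isomorphism-invariant class containing zero and closed under
submodules, quotients and extensions. -/
structure IsSerreClass (𝒮 : ∀ (X : Type u) [AddCommGroup X] [Module R X], Prop) : Prop where
  of_subsingleton : ∀ (X : Type u) [AddCommGroup X] [Module R X], Subsingleton X → 𝒮 X
  of_injective : ∀ {X Y : Type u} [AddCommGroup X] [Module R X] [AddCommGroup Y] [Module R Y]
    (f : X →ₗ[R] Y), Function.Injective f → 𝒮 Y → 𝒮 X
  of_surjective : ∀ {X Y : Type u} [AddCommGroup X] [Module R X] [AddCommGroup Y] [Module R Y]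
    (f : X →ₗ[R] Y), Function.Surjective f → 𝒮 X → 𝒮 Y
  of_submodule : ∀ {X : Type u} [AddCommGroup X] [Module R X] (A : Submodule R X),
    𝒮 A → 𝒮 (X ⧸ A) → 𝒮 X

namespace IsSerreClass

variable {𝒮 : ∀ (X : Type u) [AddCommGroup X] [Module R X], Prop} (h𝒮 : IsSerreClass (R := R) 𝒮)

include h𝒮

variable {X Y : Type u} [AddCommGroup X] [Module R X] [AddCommGroup Y] [Module R Y]

lemma of_ker (f : X →ₗ[R] Y) (hk : 𝒮 (LinearMap.ker f)) (hY : 𝒮 Y) : 𝒮 X :=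
  h𝒮.of_submodule _ hk (h𝒮.of_injective ((LinearMap.ker f).liftQ f le_rfl)
    (LinearMap.ker_eq_bot.1 (Submodule.ker_liftQ_eq_bot' _ f rfl)) hY)

lemma prod (hX : 𝒮 X) (hY : 𝒮 Y) : 𝒮 (X × Y) := by
  refine h𝒮.of_ker (LinearMap.fst R X Y) ?_ hX
  refine h𝒮.of_injective (LinearMap.snd R X Y ∘ₗ (LinearMap.ker _).subtype) ?_ hY
  rintro ⟨⟨a, b⟩, h⟩ ⟨⟨c, d⟩, h'⟩ hbd
  have h1 : a = 0 := h
  have h2 : c = 0 := h'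
  have h3 : b = d := hbd
  subst h1 h2 h3
  rfl

/-- A module with finitely many maps to members of the class which jointly have zero kernel belongs
to the class. -/
lemma of_jointly_injective {ι : Type*} (s : Finset ι) (Y : ι → Type u)
    [∀ i, AddCommGroup (Y i)] [∀ i, Module R (Y i)] (hY : ∀ i ∈ s, 𝒮 (Y i)) :
    ∀ (X : Type u) [AddCommGroup X] [Module R X] (f : ∀ i, X →ₗ[R] Y i),
      (∀ x, (∀ i ∈ s, f i x = 0) → x = 0) → 𝒮 X := by
  classical
  induction s using Finset.induction_on with
  | empty =>
    intro X _ _ f hf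
    exact h𝒮.of_subsingleton X ⟨fun x y => (hf x (by simp)).trans (hf y (by simp)).symm⟩
  | insert a s _ ih =>
    intro X _ _ f hf
    refine h𝒮.of_ker (f a) ?_ (hY a (Finset.mem_insert_self a s))
    refine ih (fun i hi => hY i (Finset.mem_insert_of_mem hi)) _
      (fun i => f i ∘ₗ (LinearMap.ker (f a)).subtype) fun x hx => Subtype.ext (hf x.1 ?_)
    intro i hi
    obtain rfl | hi := Finset.mem_insert.1 hi
    · exact x.2
    · exact hx i hi

lemma of_jointly_injective_of_finite {ι : Type*} [Finite ι] {Y : ι → Type u}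
    [∀ i, AddCommGroup (Y i)] [∀ i, Module R (Y i)] (hY : ∀ i, 𝒮 (Y i)) (f : ∀ i, X →ₗ[R] Y i)
    (hf : ∀ x, (∀ i, f i x = 0) → x = 0) : 𝒮 X := by
  have := Fintype.ofFinite ι
  exact h𝒮.of_jointly_injective Finset.univ Y (fun i _ => hY i) X f fun x hx =>
    hf x fun i => hx i (Finset.mem_univ i)

lemma span_map (f : X →ₗ[R] Y) (x : X) (hx : 𝒮 (Submodule.span R {x})) :
    𝒮 (Submodule.span R {f x}) := by
  have h : ∀ z ∈ Submodule.span R {x}, f z ∈ Submodule.span R {f x} := by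
    intro z hz
    obtain ⟨r, rfl⟩ := Submodule.mem_span_singleton.1 hz
    rw [map_smul]
    exact Submodule.smul_mem _ _ (Submodule.mem_span_singleton_self _)
  refine h𝒮.of_surjective (f.restrict h) ?_ hx
  rintro ⟨_, hy⟩
  obtain ⟨r, rfl⟩ := Submodule.mem_span_singleton.1 hy
  exact ⟨⟨r • x, Submodule.smul_mem _ _ (Submodule.mem_span_singleton_self _)⟩,
    Subtype.ext (map_smul f r x)⟩

lemma span_of_injective (f : X →ₗ[R] Y) (hf : Function.Injective f) (x : X)
    (hx : 𝒮 (Submodule.span R {f x})) : 𝒮 (Submodule.span R {x}) := by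
  have h : ∀ z ∈ Submodule.span R {x}, f z ∈ Submodule.span R {f x} := by
    intro z hz
    obtain ⟨r, rfl⟩ := Submodule.mem_span_singleton.1 hz
    rw [map_smul]
    exact Submodule.smul_mem _ _ (Submodule.mem_span_singleton_self _)
  exact h𝒮.of_injective (f.restrict h) (fun a b hab => Subtype.ext (hf (congrArg Subtype.val hab)))
    hx

variable (X) in
/-- The elements generating a cyclic submodule that belongs to the Serre class. -/
def cyclicPart : Submodule R X where
  carrier := {x | 𝒮 (Submodule.span R {x})}
  zero_mem' := h𝒮.of_subsingleton _ (by
    rw [Submodule.span_zero_singleton]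
    infer_instance)
  add_mem' := by
    intro x y hx hy
    let x' : Submodule.span R {x} := ⟨x, Submodule.mem_span_singleton_self x⟩
    let y' : Submodule.span R {y} := ⟨y, Submodule.mem_span_singleton_self y⟩
    exact h𝒮.span_map (LinearMap.coprod (Submodule.span R {x}).subtype
      (Submodule.span R {y}).subtype) (x', y')
      (h𝒮.of_injective (Submodule.subtype _) Subtype.val_injective (h𝒮.prod hx hy))
  smul_mem' := by
    intro r x hx
    have hle : Submodule.span R {r • x} ≤ Submodule.span R {x} :=
      Submodule.span_singleton_smul_le R r x
    exact h𝒮.of_injective _ (Submodule.inclusion_injective hle) hx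

/-- If a module belongs to a Serre class, then so do all cyclic submodules of all objects of its
weakly closed hull. -/
theorem span_of_weaklyClosedHull {M : ModuleCat.{u} R} (hM : 𝒮 M) {X : ModuleCat.{u} R}
    (hX : AtomSpectrum.weaklyClosedHull M X) (x : X) : 𝒮 (Submodule.span R {x}) := by
  refine hX (fun X => ∀ x : X, 𝒮 (Submodule.span R {x})) ⟨⟨?_⟩, ⟨?_⟩, fun J => ⟨?_⟩⟩ ?_ x
  · intro X Y f hf hY x
    exact h𝒮.span_of_injective f.hom ((ModuleCat.mono_iff_injective f).1 hf) x (hY _)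
  · intro X Y f hf hX y
    obtain ⟨x, rfl⟩ := (ModuleCat.epi_iff_surjective f).1 hf y
    exact h𝒮.span_map f.hom x (hX x)
  · rintro X ⟨c⟩ x
    -- The cyclic part contains the images of all summands, hence is the whole coproduct.
    have h0 : ModuleCat.ofHom (h𝒮.cyclicPart X).mkQ = 0 := by
      refine c.isColimit.hom_ext fun j => ?_
      ext y
      have hy : c.ι.app j y ∈ h𝒮.cyclicPart X := h𝒮.span_map (c.ι.app j).hom y (c.prop_diag_obj j y)
      exact (Submodule.Quotient.mk_eq_zero _).2 hy
    have h1 : (h𝒮.cyclicPart X).mkQ x = 0 :=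
      congrArg (fun f : X ⟶ ModuleCat.of R (X ⧸ h𝒮.cyclicPart X) => f.hom x) h0
    exact (Submodule.Quotient.mk_eq_zero _).1 h1
  · exact fun x => h𝒮.of_injective (Submodule.subtype _) Subtype.val_injective hM

end IsSerreClass

lemma isSerreClass_isNoetherian :
    IsSerreClass (R := R) fun X _ _ => IsNoetherian R X where
  of_subsingleton _ _ _ _ := inferInstance
  of_injective f hf _ := isNoetherian_of_injective f hf
  of_surjective f hf _ := isNoetherian_of_surjective f (LinearMap.range_eq_top.2 hf)
  of_submodule A h1 h2 := (isNoetherian_iff_submodule_quotient A).2 ⟨h1, h2⟩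

lemma isSerreClass_pow_smul_eq_zero (e : R) :
    IsSerreClass (R := R) fun X _ _ => ∃ n : ℕ, ∀ x : X, e ^ n • x = 0 where
  of_subsingleton _ _ _ _ := ⟨0, fun _ => Subsingleton.elim _ _⟩
  of_injective := by
    rintro X Y _ _ _ _ f hf ⟨n, hn⟩
    exact ⟨n, fun x => hf (by rw [map_smul, hn, map_zero])⟩
  of_surjective := by
    rintro X Y _ _ _ _ f hf ⟨n, hn⟩
    refine ⟨n, fun y => ?_⟩
    obtain ⟨x, rfl⟩ := hf y
    rw [← map_smul, hn, map_zero]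
  of_submodule := by
    rintro X _ _ A ⟨m, hm⟩ ⟨n, hn⟩
    refine ⟨m + n, fun x => ?_⟩
    have h : e ^ n • x ∈ A := (Submodule.Quotient.mk_eq_zero A).1 (hn (Submodule.Quotient.mk x))
    rw [pow_add, mul_smul]
    exact congrArg Subtype.val (hm ⟨_, h⟩)

variable {P : Type v} (M : P → Type u) [∀ p, AddCommGroup (M p)] [∀ p, Module R (M p)]

/-- `x` is hereditarily rich in copies of the modules `M p`: every nonzero subquotient of the cyclic
module `R x` of the form `R ⧸ I` contains a copy of some `M p`. The cyclic subquotients of `R x` are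
the `R ⧸ I` with `I` containing the annihilator of some `r x`. -/
def IsRichElement {X : Type u} [AddCommGroup X] [Module R X] (x : X) : Prop :=
  ∀ (r : R) (I : Submodule R R), (∀ s : R, s • r • x = 0 → s ∈ I) → (1 : R) ∉ I →
    ∃ (p : P) (j : M p →ₗ[R] R ⧸ I), Function.Injective j

lemma isSerreClass_isRichElement :
    IsSerreClass (R := R) fun X _ _ => ∀ x : X, IsRichElement (R := R) M x where
  of_subsingleton X _ _ _ x r I h h1 := absurd (h 1 (Subsingleton.elim _ _)) h1
  of_injective f hf hY x r I h h1 := by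
    refine hY (f x) r I (fun s hs => h s (hf ?_)) h1
    rw [map_smul, map_smul, hs, map_zero]
  of_surjective f hf hX y r I h h1 := by
    obtain ⟨x, rfl⟩ := hf y
    refine hX x r I (fun s hs => h s ?_) h1
    rw [← map_smul, ← map_smul, hs, map_zero]
  of_submodule {X} _ _ A hA hQ x r I h h1 := by
    by_cases hI : ∀ s : R, s • r • (Submodule.Quotient.mk x : X ⧸ A) = 0 → s ∈ I
    · exact hQ _ r I hI h1
    · push Not at hI
      obtain ⟨s, hs, hsI⟩ := hI
      have hsA : s • r • x ∈ A := (Submodule.Quotient.mk_eq_zero A).1 hs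
      -- Right multiplication by `s` embeds `R ⧸ (I : s)` into `R ⧸ I`.
      let m : R →ₗ[R] R := LinearMap.toSpanSingleton R R s
      obtain ⟨p, j, hj⟩ := hA ⟨_, hsA⟩ 1 (I.comap m)
        (fun t ht => h (t * s) (by
          rw [one_smul] at ht
          rw [mul_smul]
          exact congrArg Subtype.val ht))
        (by simpa [m] using hsI)
      have hm : Function.Injective ((I.comap m).mapQ I m le_rfl) := by
        refine LinearMap.ker_eq_bot.1 (Submodule.ker_liftQ_eq_bot' _ _ ?_)
        rw [LinearMap.ker_comp, Submodule.ker_mkQ]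
      exact ⟨p, (I.comap m).mapQ I m le_rfl ∘ₗ j, hm.comp hj⟩

end SerreClass

/-! ### Families of compressible modules indexed by a partially ordered set -/

/-- A family of modules `M p` indexed by a partially ordered set, each equipped with an injective
endomorphism `shift p`, such that the iterated images of `shift p` are cofinal among the nonzero
submodules of `M p`, while `M p ⧸ range (shift p)` is built from the modules `M q` with `p < q`.
The elements `e p` of the ring tell the modules apart: `e p` kills `M q` unless `q ≤ p`, but it is
not nilpotent on `M p`. -/
structure CompressibleFamily (R : Type u) [Ring R] (P : Type v) [PartialOrder P] (M : P → Type u)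
    [∀ p, AddCommGroup (M p)] [∀ p, Module R (M p)] where
  /-- the distinguishing element of the ring -/
  e : P → R
  /-- the compressing endomorphism -/
  shift : ∀ p, M p →ₗ[R] M p
  /-- the projections realizing larger elements as quotients -/
  proj : ∀ p q, M p →ₗ[R] M q
  shift_injective : ∀ p, Function.Injective (shift p)
  proj_surjective : ∀ p q, p < q → Function.Surjective (proj p q)
  mem_range_shift : ∀ p (y : M p), (∀ q, p < q → proj p q y = 0) → y ∈ LinearMap.range (shift p)
  exists_range_pow_le : ∀ p (y : M p), y ≠ 0 →
    ∃ n : ℕ, LinearMap.range (shift p ^ n) ≤ Submodule.span R {y}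
  e_smul_eq_zero : ∀ p q, ¬ q ≤ p → ∀ y : M q, e p • y = 0
  exists_pow_smul_ne_zero : ∀ p, ∃ x : M p, ∀ n : ℕ, e p ^ n • x ≠ 0

namespace CompressibleFamily

variable {R : Type u} [Ring R] {P : Type v} [PartialOrder P] {M : P → Type u}
  [∀ p, AddCommGroup (M p)] [∀ p, Module R (M p)] (F : CompressibleFamily R P M)

include F

lemma shift_pow_injective (p : P) (n : ℕ) : Function.Injective (F.shift p ^ n) := by
  rw [Module.End.coe_pow]
  exact (F.shift_injective p).iterate n

/-- A Serre class containing all `M q` with `q > p` contains every quotient of `M p` by a term of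
the filtration by the iterated images of the shift. -/
lemma quotient_mem_of_shift_pow [Finite P]
    {𝒮 : ∀ (X : Type u) [AddCommGroup X] [Module R X], Prop} (h𝒮 : IsSerreClass (R := R) 𝒮) (p : P)
    (hp : ∀ q, p < q → 𝒮 (M q)) (n : ℕ) :
    ∀ (X : Type u) [AddCommGroup X] [Module R X] (h : M p →ₗ[R] X), Function.Surjective h →
      (∀ y, h ((F.shift p ^ n) y) = 0) → 𝒮 X := by
  classical
  have := Fintype.ofFinite P
  induction n with
  | zero =>
    intro X _ _ h hs h0
    refine h𝒮.of_subsingleton X ⟨fun x y => ?_⟩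
    obtain ⟨x, rfl⟩ := hs x
    obtain ⟨y, rfl⟩ := hs y
    exact (h0 x).trans (h0 y).symm
  | succ n ih =>
    intro X _ _ h hs h0
    let A := LinearMap.range (h ∘ₗ F.shift p)
    have hA : 𝒮 A := by
      refine ih A (LinearMap.rangeRestrict _) (LinearMap.surjective_rangeRestrict _) fun y => ?_
      refine Subtype.ext ?_
      have := h0 y
      rw [pow_succ'] at this
      exact this
    refine h𝒮.of_submodule A hA ?_
    let N : Submodule R (M p) := ⨅ (q : P) (_ : p < q), LinearMap.ker (F.proj p q)
    have hmem : ∀ y, y ∈ N ↔ ∀ q, p < q → F.proj p q y = 0 := by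
      intro y
      simp [N, Submodule.mem_iInf]
    have hN : 𝒮 (M p ⧸ N) := by
      refine h𝒮.of_jointly_injective (Finset.univ.filter fun q => p < q) M
        (fun q hq => hp q (Finset.mem_filter.1 hq).2) _
        (fun q => if hq : p < q then N.liftQ (F.proj p q) (fun y hy => (hmem y).1 hy q hq) else 0) ?_
      intro x hx
      obtain ⟨y, rfl⟩ := Submodule.Quotient.mk_surjective N x
      rw [Submodule.Quotient.mk_eq_zero, hmem]
      intro q hq
      have := hx q (Finset.mem_filter.2 ⟨Finset.mem_univ q, hq⟩)
      rwa [dif_pos hq] at this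
    have hle : N ≤ LinearMap.ker (A.mkQ ∘ₗ h) := by
      intro y hy
      obtain ⟨z, rfl⟩ := F.mem_range_shift p y ((hmem y).1 hy)
      rw [LinearMap.mem_ker]
      exact (Submodule.Quotient.mk_eq_zero A).2 ⟨z, rfl⟩
    refine h𝒮.of_surjective (N.liftQ (A.mkQ ∘ₗ h) hle) ?_ hN
    intro x
    obtain ⟨x, rfl⟩ := A.mkQ_surjective x
    obtain ⟨y, rfl⟩ := hs x
    exact ⟨N.mkQ y, rfl⟩

/-- A Serre class containing all `M q` with `q > p` contains all proper quotients of `M p`. -/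
lemma quotient_mem [Finite P] {𝒮 : ∀ (X : Type u) [AddCommGroup X] [Module R X], Prop}
    (h𝒮 : IsSerreClass (R := R) 𝒮) (p : P) (hp : ∀ q, p < q → 𝒮 (M q)) (L : Submodule R (M p))
    {y : M p} (hy : y ∈ L) (hy0 : y ≠ 0) : 𝒮 (M p ⧸ L) := by
  obtain ⟨n, hn⟩ := F.exists_range_pow_le p y hy0
  refine F.quotient_mem_of_shift_pow h𝒮 p hp n _ L.mkQ L.mkQ_surjective fun z => ?_
  exact (Submodule.Quotient.mk_eq_zero L).2
    ((Submodule.span_singleton_le_iff_mem y L).2 hy (hn ⟨z, rfl⟩))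

theorem isNoetherian [Finite P] (p : P) : IsNoetherian R (M p) := by
  induction p using WellFoundedGT.induction with
  | ind p ih =>
  refine ⟨fun N => ?_⟩
  by_cases hN : N = ⊥
  · rw [hN]
    exact Submodule.fg_bot
  obtain ⟨y, hy, hy0⟩ := N.ne_bot_iff.1 hN
  have := F.quotient_mem isSerreClass_isNoetherian p ih (Submodule.span R {y})
    (Submodule.mem_span_singleton_self y) hy0
  refine Submodule.fg_of_fg_map_of_fg_inf_ker (Submodule.span R {y}).mkQ
    (IsNoetherian.noetherian _) ?_
  rw [Submodule.ker_mkQ, inf_eq_right.2 ((Submodule.span_singleton_le_iff_mem y N).2 hy)]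
  exact Submodule.fg_span_singleton y

/-- Each nonzero submodule of `M p` contains a copy of `M p`. -/
lemma exists_injective_of_injective (p : P) {X : Type u} [AddCommGroup X] [Module R X]
    (i : X →ₗ[R] M p) (hi : Function.Injective i) {x : X} (hx : x ≠ 0) :
    ∃ k : M p →ₗ[R] X, Function.Injective k := by
  obtain ⟨n, hn⟩ := F.exists_range_pow_le p (i x) fun h => hx (hi (h.trans i.map_zero.symm))
  have hle : ∀ y, (F.shift p ^ n) y ∈ LinearMap.range i := fun y =>
    (Submodule.span_singleton_le_iff_mem (i x) (LinearMap.range i)).2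
      (LinearMap.mem_range_self i x) (hn (LinearMap.mem_range_self _ y))
  let c : M p →ₗ[R] LinearMap.range i := LinearMap.codRestrict _ (F.shift p ^ n) hle
  have hc : Function.Injective c := fun a b hab =>
    F.shift_pow_injective p n (congrArg Subtype.val hab)
  let u := LinearEquiv.ofInjective i hi
  exact ⟨u.symm.toLinearMap ∘ₗ c, u.symm.injective.comp hc⟩

theorem isRichElement [Finite P] (p : P) (x : M p) : IsRichElement (R := R) M x := by
  induction p using WellFoundedGT.induction with
  | ind p ih =>
  intro r I hI h1
  by_cases hann : ∀ s ∈ I, s • r • x = 0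
  · -- Here `R ⧸ I` is isomorphic to the cyclic submodule generated by `r • x`.
    let t := LinearMap.toSpanSingleton R (M p) (r • x)
    obtain rfl : I = LinearMap.ker t := by
      ext s
      exact ⟨fun hs => hann s hs, fun hs => hI s hs⟩
    have hi : Function.Injective ((LinearMap.ker t).liftQ t le_rfl) :=
      LinearMap.ker_eq_bot.1 (Submodule.ker_liftQ_eq_bot' _ t rfl)
    obtain ⟨k, hk⟩ := F.exists_injective_of_injective p _ hi
      (x := Submodule.Quotient.mk 1) fun h => h1 ((Submodule.Quotient.mk_eq_zero _).1 h)
    exact ⟨p, k, hk⟩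
  · -- Here `R ⧸ I` is a subquotient of a proper quotient of `M p`.
    push Not at hann
    obtain ⟨s, hs, hs0⟩ := hann
    refine F.quotient_mem (isSerreClass_isRichElement M) p ih (Submodule.span R {s • r • x})
      (Submodule.mem_span_singleton_self _) hs0 (Submodule.Quotient.mk x) r I (fun t ht => ?_) h1
    have ht' : t • r • x ∈ Submodule.span R {s • r • x} :=
      (Submodule.Quotient.mk_eq_zero _).1 ht
    obtain ⟨t', ht'⟩ := Submodule.mem_span_singleton.1 ht'
    have h2 : t - t' * s ∈ I := hI _ (by rw [sub_smul, mul_smul, ht', sub_self])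
    simpa using I.add_mem h2 (I.smul_mem t' hs)

/-- A proper quotient of `M p` contains no nonzero submodule of `M p`, because `e p` acts
nilpotently on the former and not on the latter. -/
lemma eq_zero_of_injective_quotient [Finite P] (p : P) (L : Submodule R (M p)) {y : M p}
    (hy : y ∈ L) (hy0 : y ≠ 0) {X : Type u} [AddCommGroup X] [Module R X] (i : X →ₗ[R] M p)
    (hi : Function.Injective i) (j : X →ₗ[R] M p ⧸ L) (hj : Function.Injective j) (x : X) :
    x = 0 := by
  by_contra hx
  obtain ⟨k, hk⟩ := F.exists_injective_of_injective p i hi hx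
  obtain ⟨n, hn⟩ := F.quotient_mem (isSerreClass_pow_smul_eq_zero (F.e p)) p
    (fun q hq => ⟨1, fun z => by rw [pow_one]; exact F.e_smul_eq_zero p q (not_le_of_gt hq) z⟩) L
    hy hy0
  obtain ⟨z, hz⟩ := F.exists_pow_smul_ne_zero p
  refine hz n (hk (hj ?_))
  rw [map_smul, map_smul, hn, map_zero, map_zero]

/-- If `M p` is a subquotient of `M q`, then `q ≤ p`. -/
lemma le_of_subquotient {p q : P} {X Y : Type u} [AddCommGroup X] [Module R X] [AddCommGroup Y]
    [Module R Y] (i : X →ₗ[R] M q) (hi : Function.Injective i) (f : X →ₗ[R] Y)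
    (hf : Function.Surjective f) (k : M p →ₗ[R] Y) (hk : Function.Injective k) : q ≤ p := by
  by_contra h
  obtain ⟨z, hz⟩ := F.exists_pow_smul_ne_zero p
  obtain ⟨x, hx⟩ := hf (k z)
  refine hz 1 (hk ?_)
  have h0 : F.e p • x = 0 := hi (by rw [map_smul, F.e_smul_eq_zero p q h, map_zero])
  rw [pow_one, map_smul, ← hx, ← map_smul, h0, map_zero, map_zero]

end CompressibleFamily

/-! ### The atom spectrum of the category generated by a compressible family -/

namespace CompressibleFamily

open AtomSpectrum

variable {R : Type u} [Ring R] {P : Type v} [PartialOrder P] {M : P → Type u}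
  [∀ p, AddCommGroup (M p)] [∀ p, Module R (M p)] (F : CompressibleFamily R P M)
  {M₀ : ModuleCat.{u} R} (ρ : ∀ p, M₀ →ₗ[R] M p) (hρ : ∀ p, Function.Surjective (ρ p))

/-- `M p` as an object of the weakly closed subcategory generated by a module having `M p` as a
quotient. -/
def obj (p : P) : (weaklyClosedHull M₀).FullSubcategory :=
  ⟨ModuleCat.of R (M p),
    weaklyClosedHull_of_surjective ⟨M₀, weaklyClosedHull_self M₀⟩ (ρ p) (hρ p)⟩

lemma not_isZero_obj (F : CompressibleFamily R P M) (p : P) : ¬ IsZero (obj ρ hρ p) := by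
  rw [isZero_iff_forall_eq_zero]
  intro h
  obtain ⟨x, hx⟩ := F.exists_pow_smul_ne_zero p
  exact hx 0 (h _)

include F in
lemma exists_mono_of_mono_obj {p : P} {X : (weaklyClosedHull M₀).FullSubcategory}
    (i : X ⟶ obj ρ hρ p) [Mono i] (hX : ¬ IsZero X) : ∃ k : obj ρ hρ p ⟶ X, Mono k := by
  rw [isZero_iff_forall_eq_zero] at hX
  push Not at hX
  obtain ⟨x, hx⟩ := hX
  obtain ⟨k, hk⟩ := F.exists_injective_of_injective p i.hom.hom (injective_of_mono i) hx
  obtain ⟨g, hg, -⟩ := exists_mono_of_injective (X := obj ρ hρ p) k hk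
  exact ⟨g, hg⟩

include F in
lemma isCompressible_of_iso {p : P} {X : (weaklyClosedHull M₀).FullSubcategory}
    (e : X ≅ obj ρ hρ p) : IsCompressible X := by
  refine isCompressible_of_mono (fun h => not_isZero_obj ρ hρ F p (h.of_iso e.symm)) ?_
  intro Y i hY hi
  obtain ⟨k, hk⟩ := F.exists_mono_of_mono_obj ρ hρ (i ≫ e.hom) hY
  exact ⟨e.hom ≫ k, inferInstance⟩

include F in
lemma isMonoform_obj [Finite P] (p : P) : IsMonoform (obj ρ hρ p) := by
  refine ⟨not_isZero_obj ρ hρ F p, fun L hL N ⟨Q, ⟨e⟩⟩ => ?_⟩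
  rw [subobject_ne_bot_iff, isZero_iff_forall_eq_zero] at hL
  push Not at hL
  obtain ⟨x, hx⟩ := hL
  have hLinj := injective_of_mono L.arrow
  let L' : Submodule R (M p) := LinearMap.range L.arrow.hom.hom
  have hy0 : L.arrow.hom.hom x ≠ 0 := fun h => hx (hLinj (h.trans (map_zero _).symm))
  -- The cokernel taken in the subcategory embeds into the quotient module.
  let π := cokernel.π L.arrow
  have hπs : Function.Surjective π.hom.hom := surjective_of_epi π
  let Z : (weaklyClosedHull M₀).FullSubcategory :=
    ⟨_, weaklyClosedHull_of_surjective (obj ρ hρ p) L'.mkQ L'.mkQ_surjective⟩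
  let q : obj ρ hρ p ⟶ Z := ObjectProperty.homMk (ModuleCat.ofHom L'.mkQ)
  have hq0 : L.arrow ≫ q = 0 := by
    ext z
    exact (Submodule.Quotient.mk_eq_zero L').2 ⟨z, rfl⟩
  let d : cokernel L.arrow ⟶ Z := cokernel.desc L.arrow q hq0
  have hd : ∀ z, d.hom.hom (π.hom.hom z) = L'.mkQ z := fun z =>
    congrArg (fun g : obj ρ hρ p ⟶ Z => g.hom.hom z) (cokernel.π_desc L.arrow q hq0)
  have hdinj : Function.Injective d.hom.hom := by
    rw [← LinearMap.ker_eq_bot, LinearMap.ker_eq_bot']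
    intro z hz
    obtain ⟨z, rfl⟩ := hπs z
    rw [hd] at hz
    obtain ⟨t, rfl⟩ := (Submodule.Quotient.mk_eq_zero L').1 hz
    exact congrArg (fun g : (L : (weaklyClosedHull M₀).FullSubcategory) ⟶ cokernel L.arrow =>
      g.hom.hom t) (cokernel.condition L.arrow)
  by_contra hN
  rw [← ne_eq, subobject_ne_bot_iff, isZero_iff_forall_eq_zero] at hN
  refine hN fun n => ?_
  exact F.eq_zero_of_injective_quotient p L' (LinearMap.mem_range_self _ x) hy0 N.arrow.hom.hom
    (injective_of_mono N.arrow) (d.hom.hom ∘ₗ (e.hom ≫ Q.arrow).hom.hom)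
    (hdinj.comp (injective_of_mono (e.hom ≫ Q.arrow))) n

variable (hρ' : ∀ x, (∀ p, ρ p x = 0) → x = 0)

include F hρ' in
/-- Each nonzero object of the generated subcategory contains a copy of some `M p`. -/
lemma exists_obj_mono [Finite P] (X : (weaklyClosedHull M₀).FullSubcategory) (hX : ¬ IsZero X) :
    ∃ (p : P) (i : obj ρ hρ p ⟶ X), Mono i := by
  rw [isZero_iff_forall_eq_zero] at hX
  push Not at hX
  obtain ⟨x, hx⟩ := hX
  have h1 := (isSerreClass_isRichElement M).span_of_weaklyClosedHull
    ((isSerreClass_isRichElement M).of_jointly_injective_of_finite (fun p => F.isRichElement p) ρ hρ')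
    X.2 x
  let t := LinearMap.toSpanSingleton R X.obj x
  obtain ⟨p, j, hj⟩ := h1 ⟨x, Submodule.mem_span_singleton_self x⟩ 1 (LinearMap.ker t)
    (fun s hs => by
      rw [one_smul] at hs
      exact congrArg Subtype.val hs)
    (fun h => hx ((one_smul R x).symm.trans h))
  have hi : Function.Injective ((LinearMap.ker t).liftQ t le_rfl) :=
    LinearMap.ker_eq_bot.1 (Submodule.ker_liftQ_eq_bot' _ t rfl)
  obtain ⟨g, hg, -⟩ := exists_mono_of_injective (X := obj ρ hρ p) (Y := X)
    ((LinearMap.ker t).liftQ t le_rfl ∘ₗ j) (hi.comp hj)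
  exact ⟨p, g, hg⟩

include F hρ hρ' in
theorem exists_isCompressible [Finite P] (X : (weaklyClosedHull M₀).FullSubcategory)
    (hX : ¬ IsZero X) :
    ∃ Y : Subobject X, IsCompressible (Y : (weaklyClosedHull M₀).FullSubcategory) := by
  obtain ⟨p, i, hi⟩ := F.exists_obj_mono ρ hρ hρ' X hX
  exact ⟨Subobject.mk i, F.isCompressible_of_iso ρ hρ (Subobject.underlyingIso i)⟩

include F ρ hρ' in
theorem isNoetherian_generator [Finite P] : IsNoetherian R M₀ :=
  isSerreClass_isNoetherian.of_jointly_injective_of_finite F.isNoetherian ρ hρ'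

include F ρ hρ' in
theorem isLocallyNoetherianGrothendieck [Finite P] :
    IsLocallyNoetherianGrothendieck (weaklyClosedHull M₀).FullSubcategory :=
  isLocallyNoetherianGrothendieck_of_cyclic fun X x =>
    isSerreClass_isNoetherian.span_of_weaklyClosedHull (F.isNoetherian_generator ρ hρ') X.2 x

/-- The atom of `M p`. -/
def atom [Finite P] (p : P) : ASpec (weaklyClosedHull M₀).FullSubcategory :=
  ASpec.mk (obj ρ hρ p) (F.isMonoform_obj ρ hρ p)

include F in
lemma exists_mono_obj_of_atomEquiv {p : P} {X : (weaklyClosedHull M₀).FullSubcategory}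
    (h : AtomEquiv X (obj ρ hρ p)) : ∃ k : obj ρ hρ p ⟶ X, Mono k := by
  obtain ⟨Y, i, j, hY, hi, hj⟩ := (atomEquiv_iff _ _).1 h
  obtain ⟨k, hk⟩ := F.exists_mono_of_mono_obj ρ hρ j hY
  exact ⟨k ≫ i, inferInstance⟩

include F in
lemma le_of_mono_obj {p q : P} (k : obj ρ hρ p ⟶ obj ρ hρ q) [Mono k] : q ≤ p :=
  F.le_of_subquotient (LinearMap.id (M := M q)) Function.injective_id LinearMap.id
    Function.surjective_id k.hom.hom (injective_of_mono k)

lemma atom_injective [Finite P] : Function.Injective (F.atom ρ hρ) := by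
  have key : ∀ p q, F.atom ρ hρ p = F.atom ρ hρ q → p ≤ q := fun p q h => by
    obtain ⟨k, hk⟩ := F.exists_mono_obj_of_atomEquiv ρ hρ (Quotient.exact h)
    exact F.le_of_mono_obj ρ hρ k
  exact fun p q h => le_antisymm (key p q h) (key q p h.symm)

include hρ' in
lemma atom_surjective [Finite P] : Function.Surjective (F.atom ρ hρ) := by
  intro α
  obtain ⟨⟨H, hH⟩, rfl⟩ := Quotient.exists_rep α
  obtain ⟨p, i, hi⟩ := F.exists_obj_mono ρ hρ hρ' H hH.1
  refine ⟨p, Quotient.sound ((atomEquiv_iff _ _).2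
    ⟨obj ρ hρ p, 𝟙 _, i, not_isZero_obj ρ hρ F p, inferInstance, hi⟩)⟩

/-- The atom of `M p` lies in the support of `X` exactly if `M p` is a subquotient of `X`. -/
lemma atom_mem_aSupp_iff [Finite P] (p : P) (X : (weaklyClosedHull M₀).FullSubcategory) :
    F.atom ρ hρ p ∈ ASupp X ↔ IsSubquotient (obj ρ hρ p) X := by
  constructor
  · rintro ⟨H, hH, ⟨L, i, f, hi, hf⟩, h⟩
    obtain ⟨k, hk⟩ := F.exists_mono_obj_of_atomEquiv ρ hρ (Quotient.exact h)
    exact ⟨pullback f k, pullback.fst f k ≫ i, pullback.snd f k, inferInstance, inferInstance⟩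
  · exact fun h => ⟨_, F.isMonoform_obj ρ hρ p, h, rfl⟩

include F in
lemma isSubquotient_obj_of_le {p q : P} (h : p ≤ q) {X : (weaklyClosedHull M₀).FullSubcategory}
    (hX : IsSubquotient (obj ρ hρ p) X) : IsSubquotient (obj ρ hρ q) X := by
  obtain rfl | h := h.eq_or_lt
  · exact hX
  obtain ⟨L, i, f, hi, hf⟩ := hX
  obtain ⟨g, hg, -⟩ := exists_epi_of_surjective (X := obj ρ hρ p) (Y := obj ρ hρ q)
    (F.proj p q) (F.proj_surjective p q h)
  exact ⟨L, i, f ≫ g, hi, epi_comp f g⟩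

/-- The atom spectrum of the subcategory generated by a compressible family. -/
theorem nonempty_aSpec_orderIso [Finite P] (F : CompressibleFamily R P M)
    (hρ : ∀ p, Function.Surjective (ρ p)) (hρ' : ∀ x, (∀ p, ρ p x = 0) → x = 0) :
    Nonempty (ASpec (weaklyClosedHull M₀).FullSubcategory ≃o P) := by
  refine ⟨OrderIso.symm ⟨Equiv.ofBijective (F.atom ρ hρ) ⟨F.atom_injective ρ hρ,
    F.atom_surjective ρ hρ hρ'⟩, fun {p q} => ?_⟩⟩
  change F.atom ρ hρ p ≤ F.atom ρ hρ q ↔ p ≤ q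
  simp only [ASpec.le_iff, atom_mem_aSupp_iff]
  constructor
  · intro h
    obtain ⟨L, i, f, hi, hf⟩ := h (obj ρ hρ p) ⟨_, 𝟙 _, 𝟙 _, inferInstance, inferInstance⟩
    exact F.le_of_subquotient i.hom.hom (injective_of_mono i) f.hom.hom (surjective_of_epi f)
      (LinearMap.id (M := M q)) Function.injective_id
  · exact fun h X hX => F.isSubquotient_obj_of_le ρ hρ h hX

end CompressibleFamily

/-! ### Backward deterministic colored quivers -/

namespace ColoredQuiver

/-- A colored quiver is backward deterministic if each vertex `v` is the target of at most one arrow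
of each color `c`. The source of this arrow, if there is one, is recorded as `pred c v`. -/
structure BackwardDeterministic (Γ : ColoredQuiver.{u}) where
  /-- the source of the arrow with given color and target -/
  pred : Γ.C → Γ.V → Option Γ.V
  pred_tgt : ∀ a : Γ.A, pred (Γ.color a) (Γ.tgt a) = some (Γ.src a)
  exists_arrow : ∀ c v a, pred c v = some a → ∃ e : Γ.A, Γ.src e = a ∧ Γ.tgt e = v ∧ Γ.color e = c
  arrow_ext : ∀ e e' : Γ.A, Γ.src e = Γ.src e' → Γ.tgt e = Γ.tgt e' → Γ.color e = Γ.color e' →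
    e = e'

lemma toList_pathColor_cons (Γ : ColoredQuiver.{u}) {a b c : Γ.V} (p : Quiver.Path a b)
    (e : b ⟶ c) :
    (Γ.pathColor (p.cons e)).toList = (Γ.pathColor p).toList ++ [Γ.color (Γ.arrow e)] :=
  congrArg FreeMonoid.toList
    (Quiver.Path.weight_cons (fun {_ _ : Γ.V} e => FreeMonoid.of (Γ.color (Γ.arrow e))) p e)

namespace BackwardDeterministic

variable {Γ : ColoredQuiver.{u}} (D : Γ.BackwardDeterministic)

/-- The source of the unique path with a given target and a given sequence of colors. -/
def predWord (w : List Γ.C) (v : Γ.V) : Option Γ.V :=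
  w.foldr (fun c o => o.bind (D.pred c)) (some v)

@[simp] lemma predWord_nil (v : Γ.V) : D.predWord [] v = some v := rfl

lemma predWord_cons (c : Γ.C) (w : List Γ.C) (v : Γ.V) :
    D.predWord (c :: w) v = (D.predWord w v).bind (D.pred c) := rfl

lemma predWord_append (w w' : List Γ.C) (v : Γ.V) :
    D.predWord (w ++ w') v = (D.predWord w' v).bind (D.predWord w) := by
  induction w with
  | nil => exact (Option.bind_fun_some (D.predWord w' v)).symm
  | cons c w ih =>
    rw [List.cons_append, predWord_cons, ih, Option.bind_assoc]
    rfl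

lemma predWord_concat (w : List Γ.C) (c : Γ.C) (v : Γ.V) :
    D.predWord (w ++ [c]) v = (D.pred c v).bind (D.predWord w) := by
  rw [predWord_append, predWord_cons, predWord_nil, Option.bind_some]

lemma pred_color_arrow {a b : Γ.V} (e : a ⟶ b) :
    D.pred (Γ.color (Γ.arrow e)) b = some a := by
  obtain ⟨e, rfl, rfl⟩ := e
  exact D.pred_tgt e

lemma predWord_pathColor {a v : Γ.V} (p : Quiver.Path a v) :
    D.predWord (Γ.pathColor p).toList v = some a := by
  induction p with
  | nil =>
    rw [pathColor_nil]
    rfl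
  | cons p e ih =>
    rw [toList_pathColor_cons, predWord_concat, pred_color_arrow, Option.bind_some, ih]

lemma exists_pathColor_eq (w : List Γ.C) (v a : Γ.V) (h : D.predWord w v = some a) :
    ∃ p : Quiver.Path a v, Γ.pathColor p = FreeMonoid.ofList w := by
  induction w generalizing a with
  | nil =>
    obtain rfl : v = a := Option.some.inj h
    exact ⟨Quiver.Path.nil, pathColor_nil v⟩
  | cons c w ih =>
    rw [predWord_cons] at h
    obtain ⟨b, hb, ha⟩ := Option.bind_eq_some_iff.1 h
    obtain ⟨p, hp⟩ := ih b hb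
    obtain ⟨e, he1, he2, rfl⟩ := D.exists_arrow c b a ha
    let e' : a ⟶ b := ⟨e, he1, he2⟩
    refine ⟨(Quiver.Hom.toPath e').comp p, ?_⟩
    have he : Γ.pathColor (Quiver.Hom.toPath e') = FreeMonoid.of (Γ.color e) := by
      refine FreeMonoid.toList.injective ((toList_pathColor_cons _ _ _).trans ?_)
      rw [pathColor_nil]
      rfl
    rw [pathColor_comp, hp, he]
    rfl

include D in
lemma pathColor_injective (v : Γ.V) :
    Function.Injective fun r : Γ.PathTo v => Γ.pathColor r.2 := by
  rintro ⟨a, p⟩ ⟨a', p'⟩ h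
  replace h : Γ.pathColor p = Γ.pathColor p' := h
  induction p with
  | nil =>
    have hl := length_pathColor p'
    rw [← h, pathColor_nil] at hl
    obtain rfl := Quiver.Path.eq_of_length_zero p' hl.symm
    rw [Quiver.Path.eq_nil_of_length_zero p' hl.symm]
  | @cons b v p e ih =>
    cases p' with
    | nil =>
      have hl := length_pathColor (p.cons e)
      rw [h, pathColor_nil] at hl
      exact absurd hl (Nat.succ_ne_zero _).symm
    | @cons b' _ p' e' =>
      have h1 := congrArg FreeMonoid.toList h
      rw [toList_pathColor_cons, toList_pathColor_cons] at h1
      obtain ⟨h2, h3⟩ := List.append_inj' h1 rfl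
      have hc := (List.cons.inj h3).1
      have h4 := D.pred_color_arrow e
      rw [hc, D.pred_color_arrow e'] at h4
      obtain rfl := Option.some.inj h4
      obtain rfl : e = e' := Subtype.ext
        (D.arrow_ext _ _ (e.2.1.trans e'.2.1.symm) (e.2.2.trans e'.2.2.symm) hc)
      have hp := FreeMonoid.toList.injective h2
      obtain ⟨h5, h6⟩ := Sigma.mk.inj (ih p' hp)
      subst h5
      obtain rfl := eq_of_heq h6
      rfl

variable {K : Type u} [Field K]

/-- In a backward deterministic quiver the action of an algebra element is a sum over words. -/
lemma rightAct_eq_finsum_word (y : Γ.VertexModule K) (f : FormalMonoidAlgebra K Γ.C) (v : Γ.V) :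
    rightAct y f v =
      ∑ᶠ w : FreeMonoid Γ.C, (D.predWord w.toList v).elim 0 fun a => f.coeff w * y a := by
  let g : FreeMonoid Γ.C → K :=
    fun w => (D.predWord w.toList v).elim 0 fun a => f.coeff w * y a
  let φ : Γ.PathTo v → FreeMonoid Γ.C := fun r => Γ.pathColor r.2
  have h1 : ∀ r : Γ.PathTo v, f.coeff (Γ.pathColor r.2) * y r.1 = g (φ r) := by
    rintro ⟨a, r⟩
    simp only [g, φ]
    rw [predWord_pathColor]
    rfl
  have h2 : Function.support g ⊆ Set.range φ := by
    intro w hw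
    cases h : D.predWord w.toList v with
    | none => exact absurd (by simp [g, h]) hw
    | some a =>
      obtain ⟨p, hp⟩ := D.exists_pathColor_eq w.toList v a h
      exact ⟨⟨a, p⟩, hp⟩
  change ∑ᶠ r : Γ.PathTo v, _ = ∑ᶠ w, g w
  rw [finsum_congr h1, ← finsum_mem_range (f := g) (D.pathColor_injective v),
    ← finsum_mem_univ g, ← finsum_mem_inter_support g Set.univ,
    ← finsum_mem_inter_support g (Set.range _), Set.univ_inter, Set.inter_eq_right.2 h2]

include D in
lemma isAdmissible_of_finite (f : FormalMonoidAlgebra K Γ.C)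
    (h : ∀ v, {w : FreeMonoid Γ.C | f.coeff w ≠ 0 ∧ D.predWord w.toList v ≠ none}.Finite) :
    Γ.IsAdmissible f := by
  intro v
  refine ((h v).preimage (D.pathColor_injective v).injOn).subset fun r hr => ⟨hr, ?_⟩
  simp only
  rw [predWord_pathColor]
  simp

lemma bind_predWord {σ : Γ.V → Option Γ.V}
    (hσ : ∀ c v, (σ v).bind (D.pred c) = (D.pred c v).bind σ) (w : List Γ.C) (v : Γ.V) :
    (σ v).bind (D.predWord w) = (D.predWord w v).bind σ := by
  induction w with
  | nil => exact Option.bind_fun_some (σ v)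
  | cons c w ih =>
    have h1 : D.predWord (c :: w) = fun u => (D.predWord w u).bind (D.pred c) := rfl
    rw [h1, ← Option.bind_assoc, ih, Option.bind_assoc, Option.bind_assoc]
    exact congrArg _ (funext fun u => hσ c u)

variable (K) in
/-- Substitution along a partial self-map of the vertices that commutes with taking sources of
arrows is an endomorphism of the vertex module. -/
def substitution (σ : Γ.V → Option Γ.V)
    (hσ : ∀ c v, (σ v).bind (D.pred c) = (D.pred c v).bind σ) :
    Γ.VertexModule K →ₗ[(Γ.admissibleAlgebra K)ᵐᵒᵖ] Γ.VertexModule K where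
  toFun y := fun v => (σ v).elim 0 y
  map_add' y z := by
    funext v
    change (σ v).elim 0 (fun u => y u + z u) = (σ v).elim 0 y + (σ v).elim 0 z
    cases σ v
    · exact (add_zero 0).symm
    · rfl
  map_smul' f y := by
    funext v
    change (σ v).elim 0 (rightAct y f.unop.1) = rightAct (fun v => (σ v).elim 0 y) f.unop.1 v
    refine Eq.trans ?_ (D.rightAct_eq_finsum_word _ _ v).symm
    have key : ∀ w : FreeMonoid Γ.C,
        ((D.predWord w.toList v).elim 0 fun a => f.unop.1.coeff w * (σ a).elim 0 y) =
        ((σ v).bind (D.predWord w.toList)).elim 0 fun a => f.unop.1.coeff w * y a := by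
      intro w
      rw [D.bind_predWord hσ]
      cases D.predWord w.toList v with
      | none => rfl
      | some a =>
        change _ * (σ a).elim 0 y = (σ a).elim 0 _
        cases σ a
        · exact mul_zero _
        · rfl
    refine Eq.trans ?_ (finsum_congr key).symm
    cases σ v with
    | none => exact finsum_zero.symm
    | some u => exact D.rightAct_eq_finsum_word y f.unop.1 u

variable (K) in
/-- A single color as an element of the algebra. -/
noncomputable def colorElement (c : Γ.C) : Γ.admissibleAlgebra K :=
  open Classical in
  ⟨FormalMonoidAlgebra.ofCoeff fun w => if w = FreeMonoid.of c then 1 else 0,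
    D.isAdmissible_of_finite _ fun v => (Set.finite_singleton (FreeMonoid.of c)).subset
      fun w hw => by
        by_contra h
        exact hw.1 (if_neg h)⟩

lemma colorElement_smul_apply (c : Γ.C) (y : Γ.VertexModule K) (v : Γ.V) :
    (MulOpposite.op (D.colorElement K c) • y) v = (D.pred c v).elim 0 y := by
  refine (D.rightAct_eq_finsum_word y (D.colorElement K c).1 v).trans ?_
  have h1 : ∀ w, (D.colorElement K c).1.coeff w = open Classical in
    if w = FreeMonoid.of c then 1 else 0 := fun w => rfl
  rw [finsum_eq_single _ (FreeMonoid.of c)]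
  · change (D.pred c v).elim 0 _ = _
    rw [h1, if_pos rfl]
    simp only [one_mul]
  · intro w hw
    rw [h1, if_neg hw]
    cases D.predWord w.toList v <;> simp

include D in
lemma algebraMap_smul_apply (k : K) (y : Γ.VertexModule K) (v : Γ.V) :
    (MulOpposite.op (algebraMap K (Γ.admissibleAlgebra K) k) • y) v = k * y v := by
  refine (D.rightAct_eq_finsum_word y (algebraMap K (Γ.admissibleAlgebra K) k).1 v).trans ?_
  have h1 : ∀ w, (algebraMap K (Γ.admissibleAlgebra K) k).1.coeff w =
      k * if w.toList = [] then 1 else 0 := by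
    intro w
    change (algebraMap K (FormalMonoidAlgebra K Γ.C) k).coeff w = _
    rw [Algebra.algebraMap_eq_smul_one, FormalMonoidAlgebra.coeff_smul,
      FormalMonoidAlgebra.coeff_one]
  rw [finsum_eq_single _ 1]
  · rw [h1]
    simp
  · intro w hw
    have h2 : w.toList ≠ [] := fun h => hw (FreeMonoid.toList.injective h)
    rw [h1, if_neg h2]
    cases D.predWord w.toList v <;> simp

end BackwardDeterministic

end ColoredQuiver

/-! ### The colored quiver of a finite partially ordered set -/

namespace PosetQuiver

/-- Iterated positions: either a single point belonging to `p`, or a position `a` in the `n`-th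
layer of a block belonging to `p`. -/
inductive PreVertex (P : Type u) : Type u
  | top (p : P) : PreVertex P
  | step (p : P) (n : ℕ) (a : PreVertex P) : PreVertex P

namespace PreVertex

/-- The element of the partially ordered set to which the outermost block belongs. -/
def root {P : Type u} : PreVertex P → P
  | top p => p
  | step p _ _ => p

variable {P : Type u} [PartialOrder P]

/-- The positions used as vertices: the elements of nested blocks strictly increase, and the
innermost one is maximal. -/
def IsVertex : PreVertex P → Prop
  | top p => IsMax p
  | step p _ a => p < a.root ∧ a.IsVertex

end PreVertex

open PreVertex

/-- The vertices of the quiver of a partially ordered set. The vertices with root `p` form a single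
point if `p` is maximal. Otherwise they form countably many layers, each of which is the disjoint
union of the vertices with root `q` over all `q > p`. -/
abbrev Vertex (P : Type u) [PartialOrder P] : Type u := {v : PreVertex P // v.IsVertex}

/-- The colors: `loop p` colors a loop at the point belonging to a maximal element `p`, and
`jump p a b` colors the arrows from position `a` in a layer of a block of `p` to position `b` in the
next layer. -/
inductive Color (P : Type u) [PartialOrder P] : Type u
  | loop (p : P) : Color P
  | jump (p : P) (a b : Vertex P) : Color P

variable {P : Type u} [PartialOrder P]

/-- The element to which a color belongs. -/
def Color.base : Color P → P
  | loop p => p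
  | jump p _ _ => p

open Classical in
/-- The source of the arrow with given color and target. A color of `p` acts on the block of `p`
contained in the given position, wherever this block is nested. -/
noncomputable def preSource : Color P → PreVertex P → Option (PreVertex P)
  | .loop p, .top q => if p = q then some (.top q) else none
  | .loop p, .step q n x => (preSource (.loop p) x).map (.step q n)
  | .jump _ _ _, .top _ => none
  | .jump p a b, .step q 0 x =>
      if q = p then none else (preSource (.jump p a b) x).map (.step q 0)
  | .jump p a b, .step q (n + 1) x =>
      if q = p then if x = b.1 ∧ p < a.1.root then some (.step p n a.1) else none
      else (preSource (.jump p a b) x).map (.step q (n + 1))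

lemma preSource_jump_of_ne {p q : P} (h : q ≠ p) (a b : Vertex P) (n : ℕ) (x : PreVertex P) :
    preSource (.jump p a b) (.step q n x) = (preSource (.jump p a b) x).map (.step q n) := by
  cases n <;> simp [preSource, h]

lemma root_of_preSource_eq_some {c : Color P} {v u : PreVertex P} (h : preSource c v = some u) :
    u.root = v.root := by
  cases c with
  | loop p =>
    cases v with
    | top q =>
      simp only [preSource, Option.ite_none_right_eq_some, Option.some.injEq] at h
      rw [← h.2]
    | step q n x =>
      obtain ⟨w, -, rfl⟩ := Option.map_eq_some_iff.1 h
      rfl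
  | jump p a b =>
    cases v with
    | top q => simp [preSource] at h
    | step q n x =>
      by_cases hq : q = p
      · cases n with
        | zero => simp [preSource, hq] at h
        | succ n =>
          simp only [preSource, hq, if_true, Option.ite_none_right_eq_some, Option.some.injEq] at h
          rw [← h.2, hq]
          rfl
      · rw [preSource_jump_of_ne hq] at h
        obtain ⟨w, -, rfl⟩ := Option.map_eq_some_iff.1 h
        rfl

lemma isVertex_of_preSource_eq_some {c : Color P} {v : PreVertex P} (hv : v.IsVertex)
    {u : PreVertex P} (h : preSource c v = some u) : u.IsVertex := by
  induction v generalizing u with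
  | top q =>
    cases c with
    | loop p =>
      simp only [preSource, Option.ite_none_right_eq_some, Option.some.injEq] at h
      rw [← h.2]
      exact hv
    | jump p a b => simp [preSource] at h
  | step q n x ih =>
    have key : (preSource c x).map (.step q n) = some u → u.IsVertex := by
      intro h
      obtain ⟨w, hw, rfl⟩ := Option.map_eq_some_iff.1 h
      exact ⟨(root_of_preSource_eq_some hw).symm ▸ hv.1, ih hv.2 hw⟩
    cases c with
    | loop p => exact key h
    | jump p a b =>
      by_cases hq : q = p
      · cases n with
        | zero => simp [preSource, hq] at h
        | succ n =>
          simp only [preSource, hq, if_true, Option.ite_none_right_eq_some, Option.some.injEq] at h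
          rw [← h.2]
          exact ⟨h.1.2, a.2⟩
      · rw [preSource_jump_of_ne hq] at h
        exact key h

/-- The blocks of `p` are nested only in blocks of elements `≤ p`, so the colors of `p` act only
on vertices with root `≤ p`. -/
lemma root_le_base {c : Color P} {v : PreVertex P} (hv : v.IsVertex)
    {u : PreVertex P} (h : preSource c v = some u) : v.root ≤ c.base := by
  induction v generalizing u with
  | top q =>
    cases c with
    | loop p =>
      simp only [preSource, Option.ite_none_right_eq_some, Option.some.injEq] at h
      exact h.1.ge
    | jump p a b => simp [preSource] at h
  | step q n x ih =>
    have key : (preSource c x).map (.step q n) = some u → q ≤ c.base := by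
      intro h
      obtain ⟨w, hw, rfl⟩ := Option.map_eq_some_iff.1 h
      exact hv.1.le.trans (ih hv.2 hw)
    cases c with
    | loop p => exact key h
    | jump p a b =>
      by_cases hq : q = p
      · exact hq.le
      · rw [preSource_jump_of_ne hq] at h
        exact key h

/-! ### Partial maps of vertices commuting with sources -/

/-- Restriction of a partial map of positions to the vertices. -/
def liftPartial (σ : PreVertex P → Option (PreVertex P))
    (hσ : ∀ v u, v.IsVertex → σ v = some u → u.IsVertex) (v : Vertex P) : Option (Vertex P) :=
  (σ v.1).pmap Subtype.mk fun u hu => hσ v.1 u v.2 hu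

lemma liftPartial_eq_some_iff {σ : PreVertex P → Option (PreVertex P)}
    {hσ : ∀ v u, v.IsVertex → σ v = some u → u.IsVertex} {v u : Vertex P} :
    liftPartial σ hσ v = some u ↔ σ v.1 = some u.1 := by
  simp [liftPartial, Option.pmap_eq_some_iff, Subtype.ext_iff]
  grind

lemma liftPartial_eq_none_iff {σ : PreVertex P → Option (PreVertex P)}
    {hσ : ∀ v u, v.IsVertex → σ v = some u → u.IsVertex} {v : Vertex P} :
    liftPartial σ hσ v = none ↔ σ v.1 = none := by
  simp [liftPartial]

lemma liftPartial_bind_comm {σ τ : PreVertex P → Option (PreVertex P)}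
    {hσ : ∀ v u, v.IsVertex → σ v = some u → u.IsVertex}
    {hτ : ∀ v u, v.IsVertex → τ v = some u → u.IsVertex}
    (h : ∀ v, v.IsVertex → (σ v).bind τ = (τ v).bind σ) (v : Vertex P) :
    (liftPartial σ hσ v).bind (liftPartial τ hτ) = (liftPartial τ hτ v).bind (liftPartial σ hσ) := by
  ext u
  have hv := congrArg (fun o => o = some u.1) (h v.1 v.2)
  simp only [Option.bind_eq_some_iff, eq_iff_iff] at hv
  simp only [Option.bind_eq_some_iff, liftPartial_eq_some_iff]
  constructor
  · rintro ⟨w, h1, h2⟩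
    obtain ⟨w', h3, h4⟩ := hv.1 ⟨w, h1, h2⟩
    exact ⟨⟨w', hτ _ _ v.2 h3⟩, h3, h4⟩
  · rintro ⟨w, h1, h2⟩
    obtain ⟨w', h3, h4⟩ := hv.2 ⟨w, h1, h2⟩
    exact ⟨⟨w', hσ _ _ v.2 h3⟩, h3, h4⟩

/-- The source of the arrow with given color and target. -/
noncomputable def source (c : Color P) : Vertex P → Option (Vertex P) :=
  liftPartial (preSource c) fun _ _ hv h => isVertex_of_preSource_eq_some hv h

lemma source_eq_some_iff {c : Color P} {v u : Vertex P} :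
    source c v = some u ↔ preSource c v.1 = some u.1 :=
  liftPartial_eq_some_iff

/-- The previous position in the outermost block. -/
def preShift : PreVertex P → Option (PreVertex P)
  | .step p (n + 1) a => some (.step p n a)
  | _ => none

lemma preShift_bind_preSource (c : Color P) (v : PreVertex P) :
    (preShift v).bind (preSource c) = (preSource c v).bind preShift := by
  cases v with
  | top q =>
    cases c with
    | loop p => by_cases h : p = q <;> simp [preShift, preSource, h]
    | jump p a b => simp [preShift, preSource]
  | step q n x =>
    cases c with
    | loop p =>
      cases n <;> cases h : preSource (.loop p) x <;> simp [preShift, preSource, h]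
    | jump p a b =>
      by_cases hq : q = p
      · cases n with
        | zero => simp [preShift, preSource, hq]
        | succ n =>
          cases n <;> by_cases h : x = b.1 ∧ p < a.1.root <;> simp [preShift, preSource, hq, h]
      · rw [preSource_jump_of_ne hq]
        cases n <;> cases h : preSource (.jump p a b) x <;>
          simp [preShift, preSource_jump_of_ne hq, h]

/-- Previous position in the outermost block, on vertices. -/
def shiftVertex : Vertex P → Option (Vertex P) :=
  liftPartial preShift fun v u hv h => by
    cases v with
    | top q => simp [preShift] at h
    | step q n x =>
      cases n with
      | zero => simp [preShift] at h
      | succ n =>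
        obtain rfl : PreVertex.step q n x = u := Option.some.inj h
        exact hv

open Classical in
/-- The restriction to the vertices with root `p`. -/
noncomputable def rootVertex (p : P) : Vertex P → Option (Vertex P) :=
  fun v => if v.1.root = p then some v else none

open Classical in
/-- The inclusion of the vertices with root `> p` as the first layer of the block of `p`. -/
noncomputable def preFirst (p : P) : PreVertex P → Option (PreVertex P) :=
  fun v => if p < v.root then some (.step p 0 v) else none

lemma preFirst_bind_preSource (p : P) (c : Color P) (v : PreVertex P) (hv : v.IsVertex) :
    (preFirst p v).bind (preSource c) = (preSource c v).bind (preFirst p) := by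
  by_cases hp : p < v.root
  · have h1 : preSource c (.step p 0 v) = (preSource c v).map (.step p 0) := by
      cases c with
      | loop q => rfl
      | jump q a b =>
        by_cases hq : p = q
        · subst hq
          have h2 : preSource (.jump p a b) v = none := by
            cases h : preSource (.jump p a b) v with
            | none => rfl
            | some u => exact absurd (root_le_base hv h) (not_le_of_gt hp)
          simp [preSource, h2]
        · exact preSource_jump_of_ne hq _ _ _ _
    simp only [preFirst, hp, if_true, Option.bind_some, h1]
    cases h : preSource c v with
    | none => rfl
    | some u => simp [preFirst, root_of_preSource_eq_some h, hp]
  · simp only [preFirst, hp, if_false, Option.bind_none]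
    cases h : preSource c v with
    | none => rfl
    | some u => simp [preFirst, root_of_preSource_eq_some h, hp]

/-- The inclusion of the vertices with root `> p` as the first layer of the block of `p`, on
vertices. -/
noncomputable def firstVertex (p : P) : Vertex P → Option (Vertex P) :=
  liftPartial (preFirst p) fun v u hv h => by
    simp only [preFirst, Option.ite_none_right_eq_some, Option.some.injEq] at h
    rw [← h.2]
    exact ⟨h.1, hv⟩

lemma shiftVertex_bind_source (c : Color P) (v : Vertex P) :
    (shiftVertex v).bind (source c) = (source c v).bind shiftVertex :=
  liftPartial_bind_comm (fun v _ => preShift_bind_preSource c v) v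

lemma firstVertex_bind_source (p : P) (c : Color P) (v : Vertex P) :
    (firstVertex p v).bind (source c) = (source c v).bind (firstVertex p) :=
  liftPartial_bind_comm (fun v hv => preFirst_bind_preSource p c v hv) v

lemma root_of_source_eq_some {c : Color P} {v u : Vertex P} (h : source c v = some u) :
    u.1.root = v.1.root :=
  root_of_preSource_eq_some (source_eq_some_iff.1 h)

lemma rootVertex_bind_source (p : P) (c : Color P) (v : Vertex P) :
    (rootVertex p v).bind (source c) = (source c v).bind (rootVertex p) := by
  by_cases hp : v.1.root = p
  · cases h : source c v with
    | none => simp [rootVertex, hp, h]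
    | some u => simp [rootVertex, hp, h, root_of_source_eq_some h]
  · cases h : source c v with
    | none => simp [rootVertex, hp]
    | some u => simp [rootVertex, hp, root_of_source_eq_some h]

/-- The vertex at position `a` in the `n`-th layer of the block of `p`. -/
def stepVertex (p : P) (n : ℕ) (a : Vertex P) (h : p < a.1.root) : Vertex P :=
  ⟨.step p n a.1, h, a.2⟩

lemma exists_eq_stepVertex {p : P} (hp : ¬ IsMax p) (v : Vertex P) (hv : v.1.root = p) :
    ∃ (n : ℕ) (a : Vertex P) (h : p < a.1.root), v = stepVertex p n a h := by
  obtain ⟨v, hv'⟩ := v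
  cases v with
  | top q =>
    obtain rfl : q = p := hv
    exact absurd hv' hp
  | step q n a =>
    obtain rfl : q = p := hv
    exact ⟨n, ⟨a, hv'.2⟩, hv'.1, rfl⟩

lemma eq_of_isMax {p : P} (hp : IsMax p) (v : Vertex P) (hv : v.1.root = p) :
    v = ⟨.top p, hp⟩ := by
  obtain ⟨v, hv'⟩ := v
  cases v with
  | top q =>
    obtain rfl : q = p := hv
    rfl
  | step q n a =>
    obtain rfl : q = p := hv
    exact absurd hv'.1 hp.not_lt

lemma shiftVertex_stepVertex_zero (p : P) (a : Vertex P) (h : p < a.1.root) :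
    shiftVertex (stepVertex p 0 a h) = none :=
  liftPartial_eq_none_iff.2 rfl

lemma shiftVertex_stepVertex_succ (p : P) (n : ℕ) (a : Vertex P) (h : p < a.1.root) :
    shiftVertex (stepVertex p (n + 1) a h) = some (stepVertex p n a h) :=
  liftPartial_eq_some_iff.2 rfl

lemma firstVertex_of_lt {p : P} {v : Vertex P} (h : p < v.1.root) :
    firstVertex p v = some (stepVertex p 0 v h) :=
  liftPartial_eq_some_iff.2 (if_pos h)

lemma source_jump_stepVertex_succ (p : P) (n : ℕ) (a b : Vertex P) (ha : p < a.1.root)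
    (hb : p < b.1.root) :
    source (.jump p a b) (stepVertex p (n + 1) b hb) = some (stepVertex p n a ha) :=
  liftPartial_eq_some_iff.2 (by simp [preSource, stepVertex, ha])

lemma source_loop_top (p : P) (hp : IsMax p) :
    source (.loop p) (⟨.top p, hp⟩ : Vertex P) = some ⟨.top p, hp⟩ :=
  liftPartial_eq_some_iff.2 (by simp [preSource])

/-! ### Words of jumps -/

open Classical in
/-- The number of the layer in the block of `p`. -/
noncomputable def level (p : P) : PreVertex P → ℕ
  | .top _ => 0
  | .step q n x => if q = p then n else level p x

open Classical in
/-- The position inside the layer of the block of `p`. -/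
noncomputable def position (p : P) : PreVertex P → Option (PreVertex P)
  | .top _ => none
  | .step q _ x => if q = p then some x else position p x

lemma level_position_of_preSource {p : P} {a b : Vertex P} {v u : PreVertex P}
    (h : preSource (.jump p a b) v = some u) :
    level p v = level p u + 1 ∧ position p v = some b.1 := by
  induction v generalizing u with
  | top q => simp [preSource] at h
  | step q n x ih =>
    by_cases hq : q = p
    · cases n with
      | zero => simp [preSource, hq] at h
      | succ n =>
        simp only [preSource, hq, if_true, Option.ite_none_right_eq_some, Option.some.injEq] at h
        rw [← h.2]
        simp [level, position, hq, h.1.1]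
    · rw [preSource_jump_of_ne hq] at h
      obtain ⟨w, hw, rfl⟩ := Option.map_eq_some_iff.1 h
      simpa [level, position, hq] using ih hw

variable (P) in
/-- The colored quiver of a partially ordered set. -/
noncomputable abbrev quiver : ColoredQuiver.{u} where
  V := Vertex P
  A := {x : Color P × Vertex P × Vertex P // source x.1 x.2.2 = some x.2.1}
  C := Color P
  src x := x.1.2.1
  tgt x := x.1.2.2
  color x := x.1.1

variable (P) in
/-- The quiver of a partially ordered set is backward deterministic. -/
noncomputable def deterministic : (quiver P).BackwardDeterministic where
  pred := source
  pred_tgt a := a.2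
  exists_arrow c v a h := ⟨⟨(c, a, v), h⟩, rfl, rfl, rfl⟩
  arrow_ext _ _ h1 h2 h3 := Subtype.ext (Prod.ext h3 (Prod.ext h1 h2))

/-- The word moving from position `a` to position `b` of the next layer and then `k` layers
further at the same position. -/
def jumpWord (p : P) (a b : Vertex P) (k : ℕ) : List (Color P) :=
  .jump p a b :: List.replicate k (.jump p b b)

lemma jumpWord_injective (p : P) (a : Vertex P) :
    Function.Injective fun x : Vertex P × ℕ => FreeMonoid.ofList (jumpWord p a x.1 x.2) := by
  rintro ⟨b, k⟩ ⟨b', k'⟩ h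
  have h : jumpWord p a b k = jumpWord p a b' k' := FreeMonoid.ofList.injective h
  obtain ⟨h1, h2⟩ := List.cons.inj h
  obtain ⟨-, -, rfl⟩ := Color.jump.inj h1
  have h3 := congrArg List.length h2
  simp only [List.length_replicate] at h3
  rw [h3]

lemma level_of_predWord_replicate {p : P} {b : Vertex P} (k : ℕ) {v u : Vertex P}
    (h : (deterministic P).predWord (List.replicate k (.jump p b b)) v = some u) :
    level p v.1 = level p u.1 + k ∧ (k ≠ 0 → position p v.1 = some b.1) := by
  induction k generalizing v with
  | zero =>
    obtain rfl : v = u := Option.some.inj h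
    simp
  | succ k ih =>
    rw [List.replicate_succ', ColoredQuiver.BackwardDeterministic.predWord_concat] at h
    obtain ⟨w, h1, h2⟩ := Option.bind_eq_some_iff.1 h
    obtain ⟨h3, h4⟩ := level_position_of_preSource (source_eq_some_iff.1 h1)
    refine ⟨?_, fun _ => h4⟩
    rw [h3, (ih h2).1]
    ring

lemma level_of_predWord_jumpWord {p : P} {a b : Vertex P} {k : ℕ} {v : Vertex P}
    (h : (deterministic P).predWord (jumpWord p a b k) v ≠ none) :
    k < level p v.1 ∧ position p v.1 = some b.1 := by
  obtain ⟨u, hu⟩ := Option.ne_none_iff_exists'.1 h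
  rw [jumpWord, ColoredQuiver.BackwardDeterministic.predWord_cons] at hu
  obtain ⟨w, h1, h2⟩ := Option.bind_eq_some_iff.1 hu
  obtain ⟨h3, h4⟩ := level_position_of_preSource (source_eq_some_iff.1 h2)
  obtain ⟨h5, h6⟩ := level_of_predWord_replicate k h1
  refine ⟨by omega, ?_⟩
  cases k with
  | zero =>
    obtain rfl : v = w := Option.some.inj h1
    exact h4
  | succ k => exact h6 (Nat.succ_ne_zero k)

lemma predWord_jumpWord (p : P) (n k : ℕ) (a b : Vertex P) (ha : p < a.1.root)
    (hb : p < b.1.root) : (deterministic P).predWord (jumpWord p a b k)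
      (stepVertex p (n + k + 1) b hb) = some (stepVertex p n a ha) := by
  have h1 : ∀ m, (deterministic P).predWord (List.replicate k (.jump p b b))
      (stepVertex p (m + k) b hb) = some (stepVertex p m b hb) := by
    induction k with
    | zero => exact fun m => rfl
    | succ k ih =>
      intro m
      have h2 : (deterministic P).pred (.jump p b b) (stepVertex p (m + (k + 1)) b hb) =
          some (stepVertex p (m + k) b hb) := source_jump_stepVertex_succ p (m + k) b b hb hb
      rw [List.replicate_succ', ColoredQuiver.BackwardDeterministic.predWord_concat, h2]
      exact ih m
  rw [jumpWord, ColoredQuiver.BackwardDeterministic.predWord_cons, Nat.add_right_comm, h1]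
  exact source_jump_stepVertex_succ p n a b ha hb

end PosetQuiver

namespace PosetQuiver

/-! ### The vertex module of the quiver of a partially ordered set -/

variable (K : Type u) [Field K] {P : Type u} [PartialOrder P]

/-- The action on the vertex module, restated because the types of vertices and colors of `quiver P`
unfold during instance search. -/
noncomputable instance : Module ((quiver P).admissibleAlgebra K)ᵐᵒᵖ ((quiver P).VertexModule K) :=
  ColoredQuiver.instModuleMulOppositeSubtypeFormalMonoidAlgebraCMemSubalgebraAdmissibleAlgebraVertexModule

/-- The projection of the vertex module to the part supported on the vertices with root `p`. -/
noncomputable def restriction (p : P) :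
    (quiver P).VertexModule K →ₗ[((quiver P).admissibleAlgebra K)ᵐᵒᵖ] (quiver P).VertexModule K :=
  (deterministic P).substitution K (rootVertex p) (rootVertex_bind_source p)

/-- The part of the vertex module supported on the vertices with root `p`. -/
noncomputable abbrev block (p : P) :
    Submodule ((quiver P).admissibleAlgebra K)ᵐᵒᵖ ((quiver P).VertexModule K) :=
  LinearMap.range (restriction K p)

variable {K}

lemma restriction_apply_of_eq {p : P} (y : (quiver P).VertexModule K) {v : Vertex P}
    (hv : v.1.root = p) : restriction K p y v = y v := by
  change (rootVertex p v).elim 0 y = y v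
  rw [rootVertex, if_pos hv]
  rfl

lemma restriction_apply_of_ne {p : P} (y : (quiver P).VertexModule K) {v : Vertex P}
    (hv : v.1.root ≠ p) : restriction K p y v = 0 := by
  change (rootVertex p v).elim 0 y = 0
  rw [rootVertex, if_neg hv]
  rfl

lemma block_apply_of_ne {p : P} (y : block K p) {v : Vertex P} (hv : v.1.root ≠ p) :
    y.1 v = 0 := by
  obtain ⟨_, y, rfl⟩ := y
  exact restriction_apply_of_ne y hv

lemma block_ext {p : P} {y z : block K p} (h : ∀ v : Vertex P, v.1.root = p → y.1 v = z.1 v) :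
    y = z := by
  refine Subtype.ext (funext fun v => ?_)
  by_cases hv : v.1.root = p
  · exact h v hv
  · rw [block_apply_of_ne y hv, block_apply_of_ne z hv]

open Classical in
/-- The endomorphism of the part belonging to `p`: the shift by one layer, or the identity if `p` is
maximal. -/
noncomputable def blockShift (p : P) :
    block K p →ₗ[((quiver P).admissibleAlgebra K)ᵐᵒᵖ] block K p :=
  if IsMax p then LinearMap.id else (restriction K p).rangeRestrict ∘ₗ
    (deterministic P).substitution K shiftVertex shiftVertex_bind_source ∘ₗ (block K p).subtype

/-- The restriction of the part belonging to `p` to the copy of the part belonging to `q` in its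
first layer. -/
noncomputable def blockProj (p q : P) :
    block K p →ₗ[((quiver P).admissibleAlgebra K)ᵐᵒᵖ] block K q :=
  (restriction K q).rangeRestrict ∘ₗ
    (deterministic P).substitution K (firstVertex p) (firstVertex_bind_source p) ∘ₗ
      (block K p).subtype

lemma blockShift_of_isMax {p : P} (hp : IsMax p) :
    blockShift p = (LinearMap.id : block K p →ₗ[_] block K p) :=
  if_pos hp

lemma blockShift_apply {p : P} (hp : ¬ IsMax p) (y : block K p) (v : Vertex P)
    (hv : v.1.root = p) : (blockShift p y).1 v = (shiftVertex v).elim 0 y.1 := by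
  rw [blockShift, if_neg hp]
  exact restriction_apply_of_eq _ hv

lemma blockShift_zero {p : P} (y : block K p) (a : Vertex P) (h : p < a.1.root) :
    (blockShift p y).1 (stepVertex p 0 a h) = 0 := by
  rw [blockShift_apply (fun hp => hp.not_lt h) _ _ rfl, shiftVertex_stepVertex_zero]
  rfl

lemma blockShift_succ {p : P} (y : block K p) (n : ℕ) (a : Vertex P) (h : p < a.1.root) :
    (blockShift p y).1 (stepVertex p (n + 1) a h) = y.1 (stepVertex p n a h) := by
  rw [blockShift_apply (fun hp => hp.not_lt h) _ _ rfl, shiftVertex_stepVertex_succ]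
  rfl

lemma blockShift_pow_apply_of_lt {p : P} (y : block K p) {n m : ℕ} (hm : m < n) (a : Vertex P)
    (h : p < a.1.root) : ((blockShift p ^ n) y).1 (stepVertex p m a h) = 0 := by
  induction n generalizing m with
  | zero => omega
  | succ n ih =>
    rw [pow_succ', Module.End.mul_apply]
    cases m with
    | zero => exact blockShift_zero _ a h
    | succ m => rw [blockShift_succ, ih (Nat.lt_of_succ_lt_succ hm)]

lemma blockProj_apply {p q : P} (hpq : p < q) (y : block K p) (v : Vertex P) (hv : v.1.root = q) :
    (blockProj p q y).1 v = y.1 (stepVertex p 0 v (hv ▸ hpq)) := by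
  refine (restriction_apply_of_eq _ hv).trans ?_
  change (firstVertex p v).elim 0 y.1 = _
  rw [firstVertex_of_lt]
  rfl

lemma blockShift_injective (p : P) :
    Function.Injective (blockShift p : block K p →ₗ[_] block K p) := by
  by_cases hp : IsMax p
  · rw [blockShift_of_isMax hp]
    exact Function.injective_id
  · intro y z h
    refine block_ext fun v hv => ?_
    obtain ⟨n, a, ha, rfl⟩ := exists_eq_stepVertex hp v hv
    rw [← blockShift_succ y, ← blockShift_succ z, h]

/-- Functions on the positions of a block, described by their values at the layers. -/
lemma exists_block_apply_stepVertex (p : P) (g : ℕ → Vertex P → K) :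
    ∃ y : block K p, ∀ n a h, y.1 (stepVertex p n a h) = g n a := by
  let y : (quiver P).VertexModule K := fun v =>
    match v with
    | ⟨.top _, _⟩ => 0
    | ⟨.step _ n a, h⟩ => g n ⟨a, h.2⟩
  exact ⟨(restriction K p).rangeRestrict y, fun n a h => restriction_apply_of_eq y rfl⟩

lemma blockProj_surjective {p q : P} (hpq : p < q) :
    Function.Surjective (blockProj p q : block K p →ₗ[_] block K q) := by
  intro z
  obtain ⟨y, hy⟩ := exists_block_apply_stepVertex p fun _ a => z.1 a
  exact ⟨y, block_ext fun v hv => by rw [blockProj_apply hpq y v hv, hy]⟩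

lemma mem_range_blockShift (p : P) (y : block K p) (hy : ∀ q, p < q → blockProj p q y = 0) :
    y ∈ LinearMap.range (blockShift p : block K p →ₗ[_] block K p) := by
  by_cases hp : IsMax p
  · rw [blockShift_of_isMax hp]
    exact ⟨y, rfl⟩
  · open Classical in
    obtain ⟨z, hz⟩ := exists_block_apply_stepVertex p fun n a =>
      if h : p < a.1.root then y.1 (stepVertex p (n + 1) a h) else 0
    refine ⟨z, block_ext fun v hv => ?_⟩
    obtain ⟨n, a, ha, rfl⟩ := exists_eq_stepVertex hp v hv
    cases n with
    | zero =>
      rw [blockShift_zero, ← blockProj_apply ha y a rfl, hy _ ha]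
      rfl
    | succ n => rw [blockShift_succ, hz, dif_pos ha]

/-! ### Nonzero elements generate a tail -/

/-- The formal sum of the words `jumpWord p a b k` with coefficients `Λ b k`. -/
noncomputable def jumpSum (p : P) (a : Vertex P) (Λ : Vertex P → ℕ → K) :
    FormalMonoidAlgebra K (Color P) :=
  FormalMonoidAlgebra.ofCoeff (Function.extend
    (fun x : Vertex P × ℕ => FreeMonoid.ofList (jumpWord p a x.1 x.2)) (fun x => Λ x.1 x.2) 0)

lemma coeff_jumpSum (p : P) (a b : Vertex P) (k : ℕ) (Λ : Vertex P → ℕ → K) :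
    (jumpSum p a Λ).coeff (FreeMonoid.ofList (jumpWord p a b k)) = Λ b k := by
  change Function.extend (fun x : Vertex P × ℕ => FreeMonoid.ofList (jumpWord p a x.1 x.2))
    (fun x => Λ x.1 x.2) 0 _ = _
  exact (jumpWord_injective p a).extend_apply _ _ (b, k)

lemma exists_eq_jumpWord_of_coeff_ne_zero (p : P) (a : Vertex P) (Λ : Vertex P → ℕ → K)
    (w : FreeMonoid (Color P)) (hw : (jumpSum p a Λ).coeff w ≠ 0) :
    ∃ b k, w = FreeMonoid.ofList (jumpWord p a b k) := by
  by_contra h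
  push Not at h
  refine hw ?_
  change Function.extend (fun x : Vertex P × ℕ => FreeMonoid.ofList (jumpWord p a x.1 x.2))
    (fun x => Λ x.1 x.2) 0 w = 0
  exact Function.extend_apply' _ _ _ fun ⟨x, hx⟩ => h x.1 x.2 hx.symm

lemma isAdmissible_jumpSum (p : P) (a : Vertex P) (Λ : Vertex P → ℕ → K) :
    (quiver P).IsAdmissible (jumpSum p a Λ) := by
  refine (deterministic P).isAdmissible_of_finite _ fun v => ?_
  -- The position `b` of a word ending at `v` is determined by `v`, and its length is bounded.
  by_cases hb : ∃ b : Vertex P, position p v.1 = some b.1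
  · obtain ⟨b, hb⟩ := hb
    refine ((Finset.range (level p v.1)).finite_toSet.image
      fun k => FreeMonoid.ofList (jumpWord p a b k)).subset ?_
    rintro w ⟨hw, hv⟩
    obtain ⟨b', k, rfl⟩ := exists_eq_jumpWord_of_coeff_ne_zero p a Λ w hw
    obtain ⟨h1, h2⟩ := level_of_predWord_jumpWord hv
    obtain rfl : b = b' := Subtype.ext (Option.some.inj (hb.symm.trans h2))
    exact ⟨k, by simpa using h1, rfl⟩
  · refine Set.finite_empty.subset ?_
    rintro w ⟨hw, hv⟩
    obtain ⟨b', k, rfl⟩ := exists_eq_jumpWord_of_coeff_ne_zero p a Λ w hw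
    exact hb ⟨b', (level_of_predWord_jumpWord hv).2⟩

/-- The action of `jumpSum` is a convolution. -/
lemma rightAct_jumpSum_stepVertex {p : P} {a b : Vertex P} (ha : p < a.1.root)
    (hb : p < b.1.root) (Λ : Vertex P → ℕ → K) (y : (quiver P).VertexModule K) (j : ℕ) :
    ColoredQuiver.rightAct y (jumpSum p a Λ) (stepVertex p j b hb) =
      ∑ k ∈ Finset.range j, Λ b k * y (stepVertex p (j - 1 - k) a ha) := by
  classical
  rw [(deterministic P).rightAct_eq_finsum_word,
    finsum_eq_sum_of_support_subset (s := (Finset.range j).image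
      fun k => FreeMonoid.ofList (jumpWord p a b k)), Finset.sum_image]
  · refine Finset.sum_congr rfl fun k hk => ?_
    obtain ⟨i, rfl⟩ : ∃ i, j = i + k + 1 := ⟨j - 1 - k, by
      have := Finset.mem_range.1 hk
      omega⟩
    have h1 : i + k + 1 - 1 - k = i := by omega
    rw [FreeMonoid.toList_ofList, predWord_jumpWord p i k a b ha hb, coeff_jumpSum, h1]
    rfl
  · intro k _ k' _ h
    exact (Prod.ext_iff.1 (jumpWord_injective p a (a₁ := (b, k)) (a₂ := (b, k')) h)).2
  · intro w hw
    have h1 : (deterministic P).predWord w.toList (stepVertex p j b hb) ≠ none := by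
      intro h
      refine hw ?_
      simp only [h]
      rfl
    have h2 : (jumpSum p a Λ).coeff w ≠ 0 := by
      intro h
      refine hw ?_
      simp only [h, zero_mul]
      cases (deterministic P).predWord w.toList (stepVertex p j b hb) <;> rfl
    obtain ⟨b', k, rfl⟩ := exists_eq_jumpWord_of_coeff_ne_zero p a Λ w h2
    obtain ⟨h3, h4⟩ := level_of_predWord_jumpWord h1
    simp only [stepVertex, level, position, if_true] at h3 h4
    obtain rfl : b = b' := Subtype.ext (Option.some.inj h4)
    exact Finset.mem_coe.2 (Finset.mem_image.2 ⟨k, Finset.mem_range.2 h3, rfl⟩)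

open PowerSeries in
/-- A nonzero element of the part of a non-maximal `p` generates all elements supported on
sufficiently high layers: the coefficients of a suitable `jumpSum` are found by division of power
series. -/
lemma exists_range_pow_le_of_not_isMax {p : P} (hp : ¬ IsMax p) (y : block K p) (hy : y ≠ 0) :
    ∃ n : ℕ, LinearMap.range (blockShift p ^ n : block K p →ₗ[_] block K p) ≤
      Submodule.span ((quiver P).admissibleAlgebra K)ᵐᵒᵖ {y} := by
  obtain ⟨m, a, ha, hm⟩ : ∃ (m : ℕ) (a : Vertex P) (ha : p < a.1.root), y.1 (stepVertex p m a ha) ≠ 0 := by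
    by_contra h
    push Not at h
    refine hy (block_ext fun v hv => ?_)
    obtain ⟨m, a, ha, rfl⟩ := exists_eq_stepVertex hp v hv
    exact h m a ha
  let Y : K⟦X⟧ := PowerSeries.mk fun k => y.1 (stepVertex p k a ha)
  have hY : Y ≠ 0 := fun h => hm (by
    have := congrArg (PowerSeries.coeff m) h
    rwa [PowerSeries.coeff_mk, map_zero] at this)
  obtain ⟨N, hN⟩ := IsDiscreteValuationRing.associated_pow_irreducible hY
    PowerSeries.X_irreducible
  refine ⟨N + 1, ?_⟩
  rintro _ ⟨z, rfl⟩
  set t := (blockShift p ^ (N + 1)) z with ht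
  have hdvd : ∀ b : Vertex P, ∃ Λ : K⟦X⟧, ∀ hb : p < b.1.root,
      PowerSeries.mk (fun j => t.1 (stepVertex p j b hb)) = X * (Λ * Y) := by
    intro b
    by_cases hb : p < b.1.root
    · have h1 : X * Y ∣ PowerSeries.mk (fun j => t.1 (stepVertex p j b hb)) := by
        refine (hN.mul_left X).dvd.trans ?_
        rw [← pow_succ', PowerSeries.X_pow_dvd_iff]
        intro j hj
        rw [PowerSeries.coeff_mk]
        exact blockShift_pow_apply_of_lt z hj b hb
      obtain ⟨Λ, hΛ⟩ := h1
      exact ⟨Λ, fun _ => by rw [hΛ]; ring⟩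
    · exact ⟨0, fun h => absurd h hb⟩
  choose Λ hΛ using hdvd
  refine Submodule.mem_span_singleton.2 ⟨MulOpposite.op
    ⟨jumpSum p a fun b k => PowerSeries.coeff k (Λ b), isAdmissible_jumpSum p a _⟩, ?_⟩
  refine block_ext fun v hv => ?_
  obtain ⟨j, b, hb, rfl⟩ := exists_eq_stepVertex hp v hv
  change ColoredQuiver.rightAct y.1 (jumpSum p a fun b k => PowerSeries.coeff k (Λ b))
    (stepVertex p j b hb) = _
  rw [rightAct_jumpSum_stepVertex ha hb]
  have h2 := congrArg (PowerSeries.coeff j) (hΛ b hb)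
  rw [PowerSeries.coeff_mk] at h2
  rw [h2]
  cases j with
  | zero => simp
  | succ j =>
    rw [PowerSeries.coeff_succ_X_mul, PowerSeries.coeff_mul,
      Finset.Nat.sum_antidiagonal_eq_sum_range_succ_mk]
    refine Finset.sum_congr rfl fun k _ => ?_
    rw [PowerSeries.coeff_mk]
    rfl

lemma exists_range_pow_le (p : P) (y : block K p) (hy : y ≠ 0) :
    ∃ n : ℕ, LinearMap.range (blockShift p ^ n : block K p →ₗ[_] block K p) ≤
      Submodule.span ((quiver P).admissibleAlgebra K)ᵐᵒᵖ {y} := by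
  by_cases hp : IsMax p
  · refine ⟨0, fun z _ => ?_⟩
    let v : Vertex P := ⟨.top p, hp⟩
    have hv : y.1 v ≠ 0 := fun h => hy (block_ext fun w hw => by
      rw [eq_of_isMax hp w hw]
      exact h)
    refine Submodule.mem_span_singleton.2 ⟨MulOpposite.op (algebraMap K _ (z.1 v / y.1 v)), ?_⟩
    refine block_ext fun w hw => ?_
    rw [eq_of_isMax hp w hw]
    refine ((deterministic P).algebraMap_smul_apply _ y.1 v).trans ?_
    exact div_mul_cancel₀ _ hv
  · exact exists_range_pow_le_of_not_isMax hp y hy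

/-! ### The compressible family of a finite partially ordered set -/

/-- For each `p` there is a color of `p` with an infinite chain of arrows of this color in the block
of `p`. -/
lemma exists_color [Finite P] (p : P) :
    ∃ c : Color P, c.base = p ∧ ∃ v : ℕ → Vertex P, (∀ n, (v n).1.root = p) ∧
      ∀ n, source c (v (n + 1)) = some (v n) := by
  by_cases hp : IsMax p
  · exact ⟨.loop p, rfl, fun _ => ⟨.top p, hp⟩, fun _ => rfl, fun _ => source_loop_top p hp⟩
  · obtain ⟨q, hpq⟩ := not_isMax_iff.1 hp
    obtain ⟨r, hqr, hr⟩ := Finite.exists_le_maximal (p := fun _ : P => True) (a := q) trivial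
    have hr : IsMax r := fun s hs => hr.2 trivial hs
    let a : Vertex P := ⟨.top r, hr⟩
    have ha : p < a.1.root := hpq.trans_le hqr
    exact ⟨.jump p a a, rfl, fun n => stepVertex p n a ha, fun _ => rfl,
      fun n => source_jump_stepVertex_succ p n a a ha ha⟩

variable (K P) in
/-- The parts of the vertex module form a compressible family. -/
noncomputable def compressibleFamily [Finite P] :
    CompressibleFamily ((quiver P).admissibleAlgebra K)ᵐᵒᵖ P fun p => block K p where
  e p := MulOpposite.op ((deterministic P).colorElement K (exists_color p).choose)
  shift := blockShift
  proj := blockProj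
  shift_injective := blockShift_injective
  proj_surjective _ _ := blockProj_surjective
  mem_range_shift := mem_range_blockShift
  exists_range_pow_le := exists_range_pow_le
  e_smul_eq_zero p q hpq y := by
    obtain ⟨h1, -⟩ := (exists_color p).choose_spec
    refine block_ext fun v hv => ?_
    refine ((deterministic P).colorElement_smul_apply _ y.1 v).trans ?_
    change (source (exists_color p).choose v).elim 0 y.1 = 0
    cases h : source (exists_color p).choose v with
    | none => rfl
    | some u =>
      have h2 := root_le_base v.2 (source_eq_some_iff.1 h)
      rw [hv, h1] at h2
      exact absurd h2 hpq
  exists_pow_smul_ne_zero p := by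
    obtain ⟨-, v, hv, h⟩ := (exists_color p).choose_spec
    classical
    let x : block K p := (restriction K p).rangeRestrict fun w => if w = v 0 then 1 else 0
    have hx : ∀ n, (MulOpposite.op ((deterministic P).colorElement K
        (exists_color p).choose) ^ n • x).1 (v n) = 1 := by
      intro n
      induction n with
      | zero =>
        rw [pow_zero, one_smul]
        exact (restriction_apply_of_eq _ (hv 0)).trans (if_pos rfl)
      | succ n ih =>
        rw [pow_succ', mul_smul]
        refine ((deterministic P).colorElement_smul_apply _ _ _).trans ?_
        change (source (exists_color p).choose (v (n + 1))).elim 0 _ = 1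
        rw [h]
        exact ih
    refine ⟨x, fun n h0 => one_ne_zero (α := K) ?_⟩
    rw [← hx n, h0]
    rfl

end PosetQuiver

theorem theorem1p1 (K : Type u) [Field K] (P : Type v) [PartialOrder P] [Finite P] :
    ∃ Γ : ColoredQuiver.{u},
      IsNoetherianObject (Γ.vertexObj K) ∧
      AtomSpectrum.IsLocallyNoetherianGrothendieck (Γ.AssociatedCategory K) ∧
      (∀ X : Γ.AssociatedCategory K, ¬ IsZero X →
        ∃ Y : Subobject X, AtomSpectrum.IsCompressible (Y : Γ.AssociatedCategory K)) ∧
      Nonempty (AtomSpectrum.ASpec (Γ.AssociatedCategory K) ≃o P) := by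
  have : Small.{u} P := inferInstance
  have : Finite (Shrink.{u} P) := Finite.of_equiv P (equivShrink P)
  let F := PosetQuiver.compressibleFamily K (Shrink.{u} P)
  let ρ (p : Shrink.{u} P) := (PosetQuiver.restriction K p).rangeRestrict
  have hρ : ∀ p, Function.Surjective (ρ p) := fun p => LinearMap.surjective_rangeRestrict _
  have hρ' : ∀ x, (∀ p, ρ p x = 0) → x = 0 := by
    intro x hx
    funext v
    have h : (ρ v.1.root x).1 v = 0 := by
      rw [hx]
      rfl
    rwa [← PosetQuiver.restriction_apply_of_eq x (v := v) rfl]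
  refine ⟨PosetQuiver.quiver (Shrink.{u} P), ?_, ?_, ?_, ?_⟩
  · have : IsNoetherian ((PosetQuiver.quiver (Shrink.{u} P)).admissibleAlgebra K)ᵐᵒᵖ
        ((PosetQuiver.quiver (Shrink.{u} P)).vertexObj K).obj :=
      F.isNoetherian_generator (M₀ := (PosetQuiver.quiver _).vertexModuleObj K) ρ hρ'
    exact AtomSpectrum.isNoetherianObject_of_isNoetherian
      ((PosetQuiver.quiver (Shrink.{u} P)).vertexObj K)
  · exact F.isLocallyNoetherianGrothendieck
      (M₀ := (PosetQuiver.quiver _).vertexModuleObj K) ρ hρ'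
  · exact F.exists_isCompressible (M₀ := (PosetQuiver.quiver _).vertexModuleObj K) ρ hρ hρ'
  · obtain ⟨e⟩ := F.nonempty_aSpec_orderIso (M₀ := (PosetQuiver.quiver _).vertexModuleObj K)
      ρ hρ hρ'
    exact ⟨e.trans (orderIsoShrink.{u} P).symm⟩
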